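/- Let $K$ be an infinite field, let $m,n\ge 0$ be integers, let $S=K[x_1,\ldots,x_m,y_1,\ldots,y_n]$ be bigraded by $\deg x_i=(1,0)$ and $\deg y_j=(0,1)$, and let $Q=(y_1,\ldots,y_n)$. For a finitely generated $S$-module $N$, let $\operatorname{cd}(Q,N)=\sup\{i : H^i_Q(N)\ne 0\}$, where $H^i_Q$ denotes local cohomology with support in $Q$ (so $\operatorname{cd}(Q,0)=-\infty$), and let $\operatorname{grade}(Q,N)$ be the supremum of the lengths of the $N$-regular sequences contained in $Q$ (with $\operatorname{grade}(Q,N)=\infty$ if $QN=N$). The module $N$ is called Cohen–Macaulay with respect to $Q$ if there is an integer $q$ such that $H^i_Q(N)=0$ for all $i\neq q$. Let $M$ be a finitely generated ($\mathbb Z^2$-)bigraded $S$-module. The unmixed component $u_{Q,M}(0)$ of $M$ with respect to $Q$ is the largest bigraded submodule $N\subseteq M$ with $\operatorname{cd}(Q,N)<\operatorname{cd}(Q,M)$ (for $M=0$, put $u_{Q,M}(0)=0$). The module $M$ is called - *approximately Cohen–Macaulay with respect to $Q$* if $M/u_{Q,M}(0)$ is Cohen–Macaulay with respect to $Q$ and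 $\operatorname{grade}(Q,M)\ge\operatorname{cd}(Q,M)-1$; - *sequentially Cohen–Macaulay with respect to $Q$* if there are an integer $r\ge 0$ and a filtration $0=M_0\subsetneq M_1\subsetneq\cdots\subsetneq M_r=M$ by bigraded submodules such that each $M_i/M_{i-1}$ is Cohen–Macaulay with respect to $Q$ and $0\le\operatorname{cd}(Q,M_1/M_0)<\operatorname{cd}(Q,M_2/M_1)<\cdots<\operatorname{cd}(Q,M_r/M_{r-1})$. Then $M$ is approximately Cohen–Macaulay with respect to $Q$ if and only if $M$ is sequentially Cohen–Macaulay with respect to $Q$ and $\operatorname{grade}(Q,M)\ge\operatorname{cd}(Q,M)-1$. -/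

import Mathlib

universe u

namespace BigradedCM

section Relative

variable {R : Type u} [CommRing R] (I : Ideal R) (M : Type u) [AddCommGroup M] [Module R M]

/-- The `i`-th local cohomology module `H^i_I(M)` is nonzero. -/
def LocalCohomologyNonzero (i : ℕ) : Prop :=
  ¬ CategoryTheory.Limits.IsZero ((localCohomology I i).obj (ModuleCat.of R M))

/-- The cohomological dimension `cd(I, M)`: the supremum of all `i` with `H^i_I(M) ≠ 0`.
It is `⊥` (that is, `-∞`) when there is no such `i`, for instance for `M = 0`. -/
noncomputable def cohomDim : WithBot ℕ∞ :=
  ⨆ (i : ℕ) (_ : LocalCohomologyNonzero I M i), ((i : ℕ∞) : WithBot ℕ∞)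

open Classical in
/-- The grade of `I` on `M`: the supremum of the lengths of the `M`-regular sequences contained
in `I`, with the usual convention that it is infinite when `I M = M`. -/
noncomputable def grade : ℕ∞ :=
  if I • (⊤ : Submodule R M) = ⊤ then ⊤
  else ⨆ (rs : List R) (_ : (∀ r ∈ rs, r ∈ I) ∧ RingTheory.Sequence.IsRegular M rs),
    (rs.length : ℕ∞)

/-- `M` is Cohen–Macaulay with respect to `I`: for some `q`, `H^i_I(M) = 0` for all `i ≠ q`. -/
def IsCohenMacaulay : Prop :=
  ∃ q : ℕ, ∀ i : ℕ, i ≠ q → ¬ LocalCohomologyNonzero I M i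

variable {M}
variable {ι σ : Type*} [DecidableEq ι] [SetLike σ M] [AddSubmonoidClass σ M]
  (𝓜 : ι → σ) [DirectSum.Decomposition 𝓜]

/-- The quotient `N / N'` for submodules `N' ≤ N` of `M`. -/
abbrev SubQuotient (N' N : Submodule R M) : Type u :=
  ↥N ⧸ N'.submoduleOf N

/-- The chain `0 = F 0 ⊊ F 1 ⊊ ⋯ ⊊ F r = M` of graded submodules is a Cohen–Macaulay filtration
of the graded module `M` with respect to `I`. -/
structure IsCohenMacaulayFiltration {r : ℕ} (F : Fin (r + 1) → Submodule R M) : Prop where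
  homogeneous : ∀ i, (F i).IsHomogeneous 𝓜
  bot : F 0 = ⊥
  top : F (Fin.last r) = ⊤
  strictMono : StrictMono F
  isCohenMacaulay : ∀ i : Fin r, IsCohenMacaulay I (SubQuotient (F i.castSucc) (F i.succ))
  cohomDim_nonneg : ∀ i : Fin r, 0 ≤ cohomDim I (SubQuotient (F i.castSucc) (F i.succ))
  cohomDim_strictMono :
    StrictMono fun i : Fin r => cohomDim I (SubQuotient (F i.castSucc) (F i.succ))

/-- `M` is sequentially Cohen–Macaulay with respect to `I`: it has a Cohen–Macaulay filtration. -/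
def IsSequentiallyCohenMacaulay : Prop :=
  ∃ (r : ℕ) (F : Fin (r + 1) → Submodule R M), IsCohenMacaulayFiltration I 𝓜 F

/-- The unmixed component of the graded module `M` with respect to `I`: the largest graded
submodule `N` of `M` with `cd(I, N) < cd(I, M)`, i.e. the last proper term of the dimension
filtration of `M` with respect to `I`. It is constructed as the sum of all such `N`. -/
noncomputable def unmixedComponent : Submodule R M :=
  sSup {N : Submodule R M | N.IsHomogeneous 𝓜 ∧ cohomDim I N < cohomDim I M}

/-- `M` is approximately Cohen–Macaulay with respect to `I`: the quotient of `M` by its unmixed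
component is Cohen–Macaulay with respect to `I`, and `grade(I, M) ≥ cd(I, M) - 1`. -/
def IsApproximatelyCohenMacaulay : Prop :=
  IsCohenMacaulay I (M ⧸ unmixedComponent I 𝓜) ∧
    cohomDim I M ≤ (grade I M : WithBot ℕ∞) + 1

end Relative

section Polynomial

variable (K : Type u) [Field K] (m n : ℕ)

/-- The polynomial ring `K[x_1, …, x_m, y_1, …, y_n]`: `Sum.inl` indexes the `x_i`,
`Sum.inr` the `y_j`. -/
abbrev BiPoly : Type u := MvPolynomial (Fin m ⊕ Fin n) K

/-- The degrees `deg x_i = (1, 0)` and `deg y_j = (0, 1)`. -/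
def biWeight : Fin m ⊕ Fin n → ℤ × ℤ :=
  Sum.elim (fun _ => (1, 0)) (fun _ => (0, 1))

/-- The standard bigrading of `K[x_1, …, x_m, y_1, …, y_n]`. -/
noncomputable abbrev bigrading : ℤ × ℤ → Submodule K (BiPoly K m n) :=
  MvPolynomial.weightedHomogeneousSubmodule K (biWeight m n)

/-- The ideal `Q = (y_1, …, y_n)`. -/
noncomputable def idealQ : Ideal (BiPoly K m n) :=
  Ideal.span (Set.range fun j : Fin n => MvPolynomial.X (Sum.inr j))

end Polynomial

end BigradedCM

/-! ### Cocycle descriptions of the two models of Ext -/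

namespace CategoryTheory.ProjectiveResolution

open CategoryTheory Limits Opposite

/-! The grade condition is common to both sides, so what remains is to relate, under it, the
quotient `M/U` by the unmixed component to Cohen–Macaulay filtrations. Let `M ≠ 0` and `c = cd(Q,
M)`. If `M/U` has cohomology only in degree `c`, the grade bound gives `H^i(M) = 0` for `i < c - 1`,
and the long exact sequence leaves `U` at most degree `c - 1`; thus `0 ⊆ U ⊆ M`, with repetitions
removed, is a filtration (`isSequentiallyCohenMacaulay_of_quotient`). Conversely, let `F` be the
last proper term of a filtration. The cohomology of `F` lives in degrees below `c` and that of `M/F`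
only in degree `c`. Hence `F ⊆ U` by maximality, while `U ⊆ F` because a graded submodule of
cohomological dimension `d < c` has zero image in a graded quotient whose cohomology vanishes
through degree `d` (`isCohenMacaulay_quotient`).

The substance is `exists_top_cohomology`, a replacement for dimension theory. For a graded `N ≠ 0`
take the least number `d` of forms of degree `(0, 1)` generating `Q` up to radical on `N/(x)N`.
Removing generators by localization bounds the cohomology of every module killed by `ann N` by `d`.
Over an infinite field, minimality makes the forms algebraically independent on `N/(x)N`, which is
finite over `K[z_1, …, z_d]`. It therefore has a nonzero functional into that polynomial ring, and
this detects `H^d_Q(N) ≠ 0` through the Čech limit (`exists_parameters_not_vanishes`). The inclusion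
`N ⊆ F` comes from a grade estimate, by prime avoidance and Nakayama
(`exists_sub_one_mem_smul_eq_zero`), followed by graded Nakayama.

Vanishing of local cohomology is used in an elementary form: each Ext class on `R/I^t` dies on some
`R/I^s`. -/

lemma comp_iso_inv_comm {C : Type*} [Category* C] {E E' B B' D D' : C} {a : E ⟶ E'}
    {i : E ⟶ B} {i' : E' ⟶ B'} {m : B ⟶ B'} {m' : D ⟶ D'} (k : D ≅ B) (k' : D' ≅ B')
    (h₁ : a ≫ i' = i ≫ m) (h₂ : m' ≫ k'.hom = k.hom ≫ m) :
    a ≫ i' ≫ k'.inv = (i ≫ k.inv) ≫ m' := by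
  rw [reassoc_of% h₁, Category.assoc]
  congr 1
  rw [Iso.comp_inv_eq, Category.assoc, h₂, Iso.inv_hom_id_assoc]

variable {R : Type u} [CommRing R]

/-- `Ext` is built through opposite categories, so naturality consists of two squares, one for
derived functors and one for homology of opposite complexes, pasted by `comp_iso_inv_comm`. -/
lemma isoExt_naturality {X X' : ModuleCat.{u} R} (g : X' ⟶ X) (P : ProjectiveResolution X)
    (P' : ProjectiveResolution X') (φ : P'.complex ⟶ P.complex)
    (comm : φ.f 0 ≫ P.π.f 0 = P'.π.f 0 ≫ g) (n : ℕ) (Y : ModuleCat.{u} R) :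
    ((Ext R (ModuleCat.{u} R) n).map g.op).app Y ≫ (P'.isoExt n Y).hom =
      (P.isoExt n Y).hom ≫ HomologicalComplex.homologyMap
        ((HomologicalComplex.unopFunctor _ _).map
          (((((linearYoneda R (ModuleCat.{u} R)).obj Y).rightOp.mapHomologicalComplex
            (ComplexShape.down ℕ)).map φ).op)) n :=
  comp_iso_inv_comm (HomologicalComplex.homologyUnop _ _) (HomologicalComplex.homologyUnop _ _)
    (congrArg Quiver.Hom.unop (isoLeftDerivedObj_inv_naturality g P' P φ comm
      (((linearYoneda R (ModuleCat.{u} R)).obj Y).rightOp) n))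
    (congrArg Quiver.Hom.unop (HomologicalComplex.homologyOp_hom_naturality
      ((HomologicalComplex.unopFunctor _ _).map
          (((((linearYoneda R (ModuleCat.{u} R)).obj Y).rightOp.mapHomologicalComplex
            (ComplexShape.down ℕ)).map φ).op)) n)).symm
lemma exists_cocycle {K : CochainComplex (ModuleCat.{u} R) ℕ} {n : ℕ} (x : K.homology n) :
    ∃ z : K.cycles n, (K.homologyπ n).hom z = x :=
  (ModuleCat.epi_iff_surjective _).1 inferInstance x

lemma homologyπ_eq_zero_iff {K : CochainComplex (ModuleCat.{u} R) ℕ} {n : ℕ} (z : K.cycles n) :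
    (K.homologyπ n).hom z = 0 ↔
      ∃ w : K.X ((ComplexShape.up ℕ).prev n), (K.d _ n).hom w = (K.iCycles n).hom z := by
  have hex := (ShortComplex.ShortExact.moduleCat_exact_iff_function_exact
    (ShortComplex.mk (K.toCycles ((ComplexShape.up ℕ).prev n) n) (K.homologyπ n) (by simp))).1
    (ShortComplex.exact_of_g_is_cokernel _ (K.homologyIsCokernel _ n rfl))
  rw [show (K.homologyπ n).hom z = 0 ↔ _ from hex z]
  have hinj : Function.Injective (K.iCycles n).hom := (ModuleCat.mono_iff_injective _).1 inferInstance
  constructor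
  · rintro ⟨w, hw⟩
    refine ⟨w, ?_⟩
    rw [← hw, ← K.toCycles_i]
    rfl
  · rintro ⟨w, hw⟩
    refine ⟨w, hinj ?_⟩
    rw [← hw, ← K.toCycles_i]
    rfl



/-- By naturality the pulled-back class is represented by the cocycle composed with the chain map,
and a class is zero exactly when its cocycle is a coboundary. -/
lemma map_ext_app_eq_zero_iff {X X' : ModuleCat.{u} R} {P : ProjectiveResolution X}
    {Y : ModuleCat.{u} R} {n : ℕ} {x : ((Ext R (ModuleCat.{u} R) n).obj (op X)).obj Y}
    {z : (P.complex.linearYonedaObj R Y).cycles n}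
    (hz : ((P.complex.linearYonedaObj R Y).homologyπ n).hom z =
      (P.isoExt (R := R) n Y).hom.hom x)
    (g : X' ⟶ X) (P' : ProjectiveResolution X')
    (φ : P'.complex ⟶ P.complex) (comm : φ.f 0 ≫ P.π.f 0 = P'.π.f 0 ≫ g) :
    (((Ext R (ModuleCat.{u} R) n).map g.op).app Y).hom x = 0 ↔
      ∃ w : P'.complex.X ((ComplexShape.up ℕ).prev n) ⟶ Y,
        P'.complex.d n _ ≫ w = φ.f n ≫ ((P.complex.linearYonedaObj R Y).iCycles n).hom z := by
  have hnat := congrArg (fun q => q.hom x) (isoExt_naturality g P P' φ comm n Y)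
  have hinj : Function.Injective (P'.isoExt (R := R) n Y).hom.hom :=
    (ModuleCat.mono_iff_injective _).1 inferInstance
  rw [← map_eq_zero_iff _ hinj]
  replace hnat : (P'.isoExt n Y).hom.hom
    ((((Ext R (ModuleCat.{u} R) n).map g.op).app Y).hom x) = 
    (HomologicalComplex.homologyMap
      ((HomologicalComplex.unopFunctor _ _).map
        (((((linearYoneda R (ModuleCat.{u} R)).obj Y).rightOp.mapHomologicalComplex
          (ComplexShape.down ℕ)).map φ).op)) n).hom ((P.isoExt n Y).hom.hom x) := hnat
  rw [hnat, ← hz]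
  have h2 := congrArg (fun q => q.hom z) (HomologicalComplex.homologyπ_naturality
    ((HomologicalComplex.unopFunctor _ _).map
        (((((linearYoneda R (ModuleCat.{u} R)).obj Y).rightOp.mapHomologicalComplex
          (ComplexShape.down ℕ)).map φ).op)) n)
  have h3 := congrArg (fun q => q.hom z) (HomologicalComplex.cyclesMap_i
    ((HomologicalComplex.unopFunctor _ _).map
        (((((linearYoneda R (ModuleCat.{u} R)).obj Y).rightOp.mapHomologicalComplex
          (ComplexShape.down ℕ)).map φ).op)) n)
  refine Iff.trans (Eq.congr_left h2) ?_
  refine Iff.trans (homologyπ_eq_zero_iff (K := P'.complex.linearYonedaObj R Y) _) ?_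
  refine exists_congr fun w => ?_
  exact Eq.congr_right h3


/-- Every class in `Ext` is represented by a cocycle on a projective resolution. -/
lemma exists_rep_of_ext {X : ModuleCat.{u} R} (P : ProjectiveResolution X) (Y : ModuleCat.{u} R)
    (n : ℕ) (x : ((Ext R (ModuleCat.{u} R) n).obj (op X)).obj Y) :
    ∃ f : P.complex.X n ⟶ Y, P.complex.d (n + 1) n ≫ f = 0 ∧
      ∀ {X' : ModuleCat.{u} R} (g : X' ⟶ X) (P' : ProjectiveResolution X')
        (φ : P'.complex ⟶ P.complex) (_ : φ.f 0 ≫ P.π.f 0 = P'.π.f 0 ≫ g),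
        (((Ext R (ModuleCat.{u} R) n).map g.op).app Y).hom x = 0 ↔
          ∃ w : P'.complex.X ((ComplexShape.up ℕ).prev n) ⟶ Y,
            P'.complex.d n _ ≫ w = φ.f n ≫ f := by
  obtain ⟨z, hz⟩ := exists_cocycle ((P.isoExt (R := R) n Y).hom.hom x)
  exact ⟨((P.complex.linearYonedaObj R Y).iCycles n).hom z,
    congrArg (fun q => q.hom z) ((P.complex.linearYonedaObj R Y).iCycles_d n (n + 1)),
    fun g P' φ comm => map_ext_app_eq_zero_iff hz g P' φ comm⟩

/-- Every cocycle on a projective resolution represents a class in `Ext`. -/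
lemma exists_ext_of_rep {X : ModuleCat.{u} R} (P : ProjectiveResolution X) (Y : ModuleCat.{u} R)
    (n : ℕ) (f : P.complex.X n ⟶ Y) (hf : P.complex.d (n + 1) n ≫ f = 0) :
    ∃ x : ((Ext R (ModuleCat.{u} R) n).obj (op X)).obj Y,
      ∀ {X' : ModuleCat.{u} R} (g : X' ⟶ X) (P' : ProjectiveResolution X')
        (φ : P'.complex ⟶ P.complex) (_ : φ.f 0 ≫ P.π.f 0 = P'.π.f 0 ≫ g),
        (((Ext R (ModuleCat.{u} R) n).map g.op).app Y).hom x = 0 ↔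
          ∃ w : P'.complex.X ((ComplexShape.up ℕ).prev n) ⟶ Y,
            P'.complex.d n _ ≫ w = φ.f n ≫ f := by
  let K := P.complex.linearYonedaObj R Y
  have hex := (ShortComplex.ShortExact.moduleCat_exact_iff_function_exact
    (ShortComplex.mk (K.iCycles n) (K.d n (n + 1)) (by simp))).1
    (ShortComplex.exact_of_f_is_kernel _ (K.cyclesIsKernel n _ (by simp)))
  obtain ⟨z, hz⟩ := (hex f).1 hf
  refine ⟨(P.isoExt (R := R) n Y).inv.hom ((K.homologyπ n).hom z), ?_⟩
  intro X' g P' φ comm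
  rw [map_ext_app_eq_zero_iff (z := z) _ g P' φ comm]
  · exact exists_congr fun w => Eq.congr_right (congrArg (fun q => φ.f n ≫ q) hz)
  · exact (congrArg (fun q => q.hom ((K.homologyπ n).hom z))
      (P.isoExt (R := R) n Y).inv_hom_id).symm

/-- The new `Ext` in terms of cocycles. -/
lemma extMk_eq_zero_iff' {X Y : ModuleCat.{u} R} (P : ProjectiveResolution X) {n : ℕ}
    (f : P.complex.X n ⟶ Y) (hf : P.complex.d (n + 1) n ≫ f = 0) :
    P.extMk f (n + 1) rfl hf = 0 ↔
      ∃ w : P.complex.X ((ComplexShape.up ℕ).prev n) ⟶ Y, P.complex.d n _ ≫ w = f := by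
  rcases n with _ | n
  -- `prev 0` takes the default value `0`, so this differential is zero: a coboundary in degree `0`
  -- is the zero map.
  · have h0 : P.complex.d 0 ((ComplexShape.up ℕ).prev 0) = 0 := by
      apply P.complex.shape; simp
    simp only [h0, zero_comp, exists_const]
    constructor
    · intro h
      rw [← P.extEquivCohomologyClass.apply_eq_iff_eq, extEquivCohomologyClass_extMk,
        extEquivCohomologyClass_zero, CochainComplex.HomComplex.CohomologyClass.mk_eq_zero_iff,
        CochainComplex.HomComplex.Cocycle.toSingleMk_mem_coboundaries_iff _ _ _ _ _ 1 (by simp)] at h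
      obtain ⟨g, hg⟩ := h
      have hz : IsZero (P.cochainComplex.X 1) :=
        CochainComplex.isZero_of_isStrictlyLE _ 0 _
      rw [hz.eq_of_src g 0, comp_zero] at hg
      rw [← cancel_epi (P.cochainComplexXIso (-((0 : ℕ) : ℤ)) 0 rfl).hom, ← hg, comp_zero]
    · rintro h
      subst h
      simp
  · rw [extMk_eq_zero_iff _ _ _ _ _ n rfl]
    rw [show (ComplexShape.up ℕ).prev (n + 1) = n by simp]

end CategoryTheory.ProjectiveResolution

/-! ### Local cohomology vanishing as death of Ext classes -/

namespace BigradedCM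

open CategoryTheory Limits Opposite

section LocalCohomology

variable {R : Type u} [CommRing R] (I : Ideal R)

/-- The projection `R ⧸ I ^ s ⟶ R ⧸ I ^ t` for `t ≤ s`. -/
noncomputable def quotPowMap {t s : ℕ} (h : t ≤ s) :
    ModuleCat.of R (R ⧸ I ^ s) ⟶ ModuleCat.of R (R ⧸ I ^ t) :=
  ModuleCat.ofHom (Submodule.mapQ _ _ LinearMap.id (Ideal.pow_le_pow_right h))

/-- Every class in `Ext^i(R ⧸ I ^ t, X)` dies in some `Ext^i(R ⧸ I ^ s, X)`. -/
def LocalCohomologyVanishes (i : ℕ) (X : Type u) [AddCommGroup X] [Module R X] : Prop :=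
  ∀ (t : ℕ) (e : Abelian.Ext.{u} (ModuleCat.of R (R ⧸ I ^ t)) (ModuleCat.of R X) i), ∃ (s : ℕ) (h : t ≤ s),
    (Abelian.Ext.mk₀ (quotPowMap I h)).comp e (zero_add i) = 0

lemma isZero_colimit_iff {J : Type} [SmallCategory J] [IsFiltered J] (F : J ⥤ ModuleCat.{u} R) :
    IsZero (colimit F) ↔
      ∀ (j : J) (x : F.obj j), ∃ (j' : J) (f : j ⟶ j'), (F.map f).hom x = 0 := by
  have : PreservesFilteredColimitsOfSize.{0, 0} (forget (ModuleCat.{u} R)) :=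
    preservesFilteredColimitsOfSize_shrink.{0, u, 0, u} _
  constructor
  · intro h j x
    refine Concrete.colimit_rep_eq_zero.{u, 0} R F j x ?_
    rw [h.eq_of_tgt (colimit.ι F j) 0]
    rfl
  · intro h
    have : Subsingleton (colimit F : ModuleCat.{u} R) := by
      refine subsingleton_of_forall_eq 0 fun y => ?_
      obtain ⟨j, x, rfl⟩ := Concrete.colimit_exists_rep F y
      obtain ⟨j', f, hf⟩ := h j x
      have h1 := congrArg (fun q => q.hom x) (colimit.w F f)
      have h2 : (colimit.ι F j).hom x = (colimit.ι F j').hom ((F.map f).hom x) := h1.symm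
      rw [hf, map_zero] at h2
      exact h2
    exact ModuleCat.isZero_of_subsingleton _

lemma isZero_localCohomology_iff (i : ℕ) (X : ModuleCat.{u} R) :
    IsZero ((localCohomology I i).obj X) ↔
      ∀ (t : ℕ) (x : ((_root_.Ext R (ModuleCat.{u} R) i).obj
        (op (ModuleCat.of R (R ⧸ I ^ t)))).obj X), ∃ (s : ℕ) (h : t ≤ s),
          (((_root_.Ext R (ModuleCat.{u} R) i).map (quotPowMap I h).op).app X).hom x = 0 := by
  have e : (localCohomology I i).obj X ≅ _ := colimitObjIsoColimitCompEvaluation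
    (localCohomology.diagram (localCohomology.idealPowersDiagram I) i) X
  rw [e.isZero_iff, isZero_colimit_iff]
  constructor
  · intro h t x
    obtain ⟨j', f, hf⟩ := h (op (op t)) x
    exact ⟨j'.unop.unop, f.unop.unop.down.down, hf⟩
  · intro h j x
    obtain ⟨s, hs, hx⟩ := h j.unop.unop x
    exact ⟨op (op s), (homOfLE hs).op.op, hx⟩

/-- On fixed resolutions of the `R ⧸ I ^ t`, both models of Ext express death under a transition map
by the same coboundary condition. Only vanishing is compared, so no isomorphism between the models
is needed. -/
lemma isZero_localCohomology_iff_vanishes (i : ℕ) (X : Type u) [AddCommGroup X] [Module R X] :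
    IsZero ((localCohomology I i).obj (ModuleCat.of R X)) ↔ LocalCohomologyVanishes I i X := by
  rw [isZero_localCohomology_iff]
  let P : ∀ Y : ModuleCat.{u} R, ProjectiveResolution Y := fun Y => projectiveResolution Y
  have comm : ∀ {t s : ℕ} (h : t ≤ s),
      (ProjectiveResolution.lift (quotPowMap I h) (P _) (P _)).f 0 ≫ (P _).π.f 0 =
        (P _).π.f 0 ≫ quotPowMap I h := fun h => ProjectiveResolution.lift_commutes_zero _ _ _
  constructor
  · intro H t e
    obtain ⟨f, hf, rfl⟩ := (P (ModuleCat.of R (R ⧸ I ^ t))).extMk_surjective e (i + 1) rfl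
    obtain ⟨x, hx⟩ := (P (ModuleCat.of R (R ⧸ I ^ t))).exists_ext_of_rep (ModuleCat.of R X) i f hf
    obtain ⟨s, h, hs⟩ := H t x
    refine ⟨s, h, ?_⟩
    rw [ProjectiveResolution.mk₀_comp_extMk f _ rfl hf
      (φ := (⟨ProjectiveResolution.lift (quotPowMap I h) (P _) (P _), comm h⟩ :
        ProjectiveResolution.Hom (P _) (P _) (quotPowMap I h))),
      ProjectiveResolution.extMk_eq_zero_iff']
    exact (hx _ _ _ (comm h)).1 hs
  · intro H t x
    obtain ⟨f, hf, hx⟩ := (P (ModuleCat.of R (R ⧸ I ^ t))).exists_rep_of_ext (ModuleCat.of R X) i x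
    obtain ⟨s, h, hs⟩ := H t ((P (ModuleCat.of R (R ⧸ I ^ t))).extMk f (i + 1) rfl hf)
    refine ⟨s, h, ?_⟩
    rw [ProjectiveResolution.mk₀_comp_extMk f _ rfl hf
      (φ := (⟨ProjectiveResolution.lift (quotPowMap I h) (P _) (P _), comm h⟩ :
        ProjectiveResolution.Hom (P _) (P _) (quotPowMap I h))),
      ProjectiveResolution.extMk_eq_zero_iff'] at hs
    exact (hx _ _ _ (comm h)).2 hs

end LocalCohomology

end BigradedCM

/-! ### Exact sequences, invertible multiplications and regular elements -/

namespace BigradedCM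

open CategoryTheory Limits Opposite
open scoped Pointwise

section LocalCohomology

variable {R : Type u} [CommRing R] (I : Ideal R)
variable {A B C : Type u} [AddCommGroup A] [AddCommGroup B] [AddCommGroup C]
  [Module R A] [Module R B] [Module R C]

/-- The short complex of modules attached to an exact pair of linear maps. -/
abbrev exactShortComplex (f : A →ₗ[R] B) (g : B →ₗ[R] C) (h : Function.Exact f g) :
    ShortComplex (ModuleCat.{u} R) :=
  ModuleCat.shortComplexOfCompEqZero f g h.linearMap_comp_eq_zero

lemma exactShortComplex_shortExact {f : A →ₗ[R] B} {g : B →ₗ[R] C} (hf : Function.Injective f)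
    (h : Function.Exact f g) (hg : Function.Surjective g) :
    (exactShortComplex f g h).ShortExact :=
  ModuleCat.shortComplex_shortExact _ h hf hg

variable {I}

lemma quotPowMap_comp {t s r : ℕ} (h : t ≤ s) (h' : s ≤ r) :
    quotPowMap I h' ≫ quotPowMap I h = quotPowMap I (h.trans h') := by
  ext
  rfl

/-- If `H^{i-1}(C) = 0` then a class in `Ext^i(R ⧸ I ^ t, A)` that dies in `B` dies in
`H^i_I(A)`. -/
lemma exists_quotPowMap_comp_eq_zero {f : A →ₗ[R] B} {g : B →ₗ[R] C} (hf : Function.Injective f)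
    (h : Function.Exact f g) (hg : Function.Surjective g) {i : ℕ}
    (hC : ∀ j, j + 1 = i → LocalCohomologyVanishes I j C) {t : ℕ}
    (e : Abelian.Ext.{u} (ModuleCat.of R (R ⧸ I ^ t)) (ModuleCat.of R A) i)
    (he : e.comp (Abelian.Ext.mk₀ (ModuleCat.ofHom f)) (add_zero i) = 0) :
    ∃ (s : ℕ) (h : t ≤ s), (Abelian.Ext.mk₀ (quotPowMap I h)).comp e (zero_add i) = 0 := by
  have hS := exactShortComplex_shortExact hf h hg
  rcases i with _ | i
  · have : Mono (ModuleCat.ofHom f) := (ModuleCat.mono_iff_injective _).2 hf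
    have h0 : e = 0 := Abelian.Ext.postcomp_mk₀_injective_of_mono _ (ModuleCat.ofHom f)
      (by simpa using he)
    exact ⟨t, le_rfl, by simp [h0]⟩
  · obtain ⟨x, rfl⟩ := Abelian.Ext.covariant_sequence_exact₁ _ hS e he rfl
    obtain ⟨s, hs, hx⟩ := hC i rfl t x
    refine ⟨s, hs, ?_⟩
    rw [← Abelian.Ext.comp_assoc (a₁₂ := i) (a₂₃ := i + 1) _ _ _ (by omega) (by omega) (by omega)]
    erw [hx]
    simp

/-- A class dies in two stages: on a first `R ⧸ I ^ s` its image in `C` vanishes, so it lifts to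
`A`, and the lift dies on a later `R ⧸ I ^ r`. -/
lemma LocalCohomologyVanishes.of_exact_middle {f : A →ₗ[R] B} {g : B →ₗ[R] C}
    (hf : Function.Injective f) (h : Function.Exact f g) (hg : Function.Surjective g) {i : ℕ}
    (hA : LocalCohomologyVanishes I i A) (hC : LocalCohomologyVanishes I i C) :
    LocalCohomologyVanishes I i B := by
  have hS := exactShortComplex_shortExact hf h hg
  intro t e
  obtain ⟨s, hs, hx⟩ := hC t (e.comp (Abelian.Ext.mk₀ (ModuleCat.ofHom g)) (add_zero i))
  rw [← Abelian.Ext.comp_assoc (a₁₂ := i) (a₂₃ := i) _ _ _ (by omega) (by omega) (by omega)] at hx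
  obtain ⟨y, hy⟩ := Abelian.Ext.covariant_sequence_exact₂ _ hS _ hx
  obtain ⟨r, hr, hyr⟩ := hA s y
  refine ⟨r, hs.trans hr, ?_⟩
  rw [← quotPowMap_comp hs hr, ← Abelian.Ext.mk₀_comp_mk₀,
    Abelian.Ext.comp_assoc (a₁₂ := 0) (a₂₃ := i) _ _ _ (by omega) (by omega) (by omega)]
  erw [← hy]
  rw [← Abelian.Ext.comp_assoc (a₁₂ := i) (a₂₃ := i) _ _ _ (by omega) (by omega) (by omega)]
  erw [hyr]
  simp

lemma LocalCohomologyVanishes.of_exact_left {f : A →ₗ[R] B} {g : B →ₗ[R] C}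
    (hf : Function.Injective f) (h : Function.Exact f g) (hg : Function.Surjective g) {i : ℕ}
    (hB : LocalCohomologyVanishes I i B)
    (hC : ∀ j, j + 1 = i → LocalCohomologyVanishes I j C) :
    LocalCohomologyVanishes I i A := by
  intro t e
  obtain ⟨s, hs, hx⟩ := hB t (e.comp (Abelian.Ext.mk₀ (ModuleCat.ofHom f)) (add_zero i))
  rw [← Abelian.Ext.comp_assoc (a₁₂ := i) (a₂₃ := i) _ _ _ (by omega) (by omega) (by omega)] at hx
  obtain ⟨r, hr, hyr⟩ := exists_quotPowMap_comp_eq_zero hf h hg hC _ hx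
  refine ⟨r, hs.trans hr, ?_⟩
  rw [← quotPowMap_comp hs hr, ← Abelian.Ext.mk₀_comp_mk₀,
    Abelian.Ext.comp_assoc (a₁₂ := 0) (a₂₃ := i) _ _ _ (by omega) (by omega) (by omega)]
  exact hyr

lemma LocalCohomologyVanishes.of_exact_right {f : A →ₗ[R] B} {g : B →ₗ[R] C}
    (hf : Function.Injective f) (h : Function.Exact f g) (hg : Function.Surjective g) {i : ℕ}
    (hB : LocalCohomologyVanishes I i B) (hA : LocalCohomologyVanishes I (i + 1) A) :
    LocalCohomologyVanishes I i C := by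
  have hS := exactShortComplex_shortExact hf h hg
  intro t e
  obtain ⟨s, hs, hx⟩ := hA t (e.comp hS.extClass rfl)
  rw [← Abelian.Ext.comp_assoc (a₁₂ := i) (a₂₃ := i + 1) _ _ _ (by omega) (by omega) (by omega)] at hx
  obtain ⟨y, hy⟩ := Abelian.Ext.covariant_sequence_exact₃ _ hS _ _ hx
  obtain ⟨r, hr, hyr⟩ := hB s y
  refine ⟨r, hs.trans hr, ?_⟩
  rw [← quotPowMap_comp hs hr, ← Abelian.Ext.mk₀_comp_mk₀,
    Abelian.Ext.comp_assoc (a₁₂ := 0) (a₂₃ := i) _ _ _ (by omega) (by omega) (by omega)]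
  erw [← hy]
  rw [← Abelian.Ext.comp_assoc (a₁₂ := i) (a₂₃ := i) _ _ _ (by omega) (by omega) (by omega)]
  erw [hyr]
  simp

lemma LocalCohomologyVanishes.of_equiv (e : A ≃ₗ[R] B) {i : ℕ}
    (hA : LocalCohomologyVanishes I i A) : LocalCohomologyVanishes I i B := by
  intro t x
  obtain ⟨s, hs, hx⟩ := hA t (x.comp (Abelian.Ext.mk₀ (ModuleCat.ofHom e.symm.toLinearMap)) (add_zero i))
  refine ⟨s, hs, ?_⟩
  have h := congrArg (fun y => y.comp
    (Abelian.Ext.mk₀ (ModuleCat.ofHom e.toLinearMap)) (add_zero i)) hx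
  simp only [Abelian.Ext.zero_comp] at h
  rw [← h, Abelian.Ext.comp_assoc (a₁₂ := i) (a₂₃ := i) _ _ _ (by omega) (by omega) (by omega),
    Abelian.Ext.comp_assoc (a₁₂ := i) (a₂₃ := 0) _ _ _ (by omega) (by omega) (by omega),
    Abelian.Ext.mk₀_comp_mk₀, ← ModuleCat.ofHom_comp]
  simp

lemma LocalCohomologyVanishes.of_subsingleton [Subsingleton A] (i : ℕ) :
    LocalCohomologyVanishes I i A := by
  intro t x
  refine ⟨t, le_rfl, ?_⟩
  have h0 : 𝟙 (ModuleCat.of R A) = 0 := (ModuleCat.isZero_of_subsingleton _).eq_of_src _ _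
  rw [← Abelian.Ext.comp_mk₀_id x, h0]
  simp

lemma pow_smul_ext_eq_zero {z : R} (hz : z ∈ I) {t i : ℕ}
    (e : Abelian.Ext.{u} (ModuleCat.of R (R ⧸ I ^ t)) (ModuleCat.of R A) i) : z ^ t • e = 0 := by
  have h : (z ^ t • 𝟙 (ModuleCat.of R (R ⧸ I ^ t))) = 0 := by
    refine ModuleCat.hom_ext (LinearMap.ext fun x => ?_)
    obtain ⟨y, rfl⟩ := Ideal.Quotient.mk_surjective x
    change z ^ t • Ideal.Quotient.mk (I ^ t) y = 0
    rw [Algebra.smul_def, Ideal.Quotient.algebraMap_eq, ← map_mul, Ideal.Quotient.eq_zero_iff_mem]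
    exact Ideal.mul_mem_right _ _ (Ideal.pow_mem_pow hz t)
  rw [← Abelian.Ext.mk₀_id_comp e, ← Abelian.Ext.smul_comp, ← Abelian.Ext.mk₀_smul, h]
  simp

lemma smul_ext_eq_comp {r : R} {X Y : ModuleCat.{u} R} {i : ℕ} (e : Abelian.Ext.{u} X Y i) :
    r • e = e.comp (Abelian.Ext.mk₀ (r • 𝟙 Y)) (add_zero i) :=
  Abelian.Ext.smul_eq_comp_mk₀ e r

/-- `z ^ t` kills `R ⧸ I ^ t`, hence every Ext class out of it, yet acts invertibly through `A`. -/
lemma LocalCohomologyVanishes.of_bijective {z : R} (hz : z ∈ I)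
    (hA : Function.Bijective fun a : A => z • a) (i : ℕ) : LocalCohomologyVanishes I i A := by
  intro t e
  refine ⟨t, le_rfl, ?_⟩
  have hb : Function.Bijective (LinearMap.lsmul R A (z ^ t)) := by
    have : ⇑(LinearMap.lsmul R A (z ^ t)) = (fun a : A => z • a)^[t] := by
      ext a; simp [smul_iterate_apply]
    rw [this]
    exact hA.iterate t
  let φ := LinearEquiv.ofBijective _ hb
  have h1 : e.comp (Abelian.Ext.mk₀ (ModuleCat.ofHom φ.toLinearMap)) (add_zero i) = 0 := by
    rw [← pow_smul_ext_eq_zero hz e, smul_ext_eq_comp]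
    rfl
  have h := congrArg (fun y => y.comp
    (Abelian.Ext.mk₀ (ModuleCat.ofHom φ.symm.toLinearMap)) (add_zero i)) h1
  simp only [Abelian.Ext.zero_comp] at h
  rw [Abelian.Ext.comp_assoc (a₁₂ := i) (a₂₃ := 0) _ _ _ (by omega) (by omega) (by omega),
    Abelian.Ext.mk₀_comp_mk₀, ← ModuleCat.ofHom_comp] at h
  simp at h
  simp [h]

/-- Such an element is the image of `1` under a map out of `R ⧸ I ^ t`, and precomposing with a
projection of quotients loses nothing. -/
lemma eq_zero_of_vanishes_zero (h : LocalCohomologyVanishes I 0 A) {t : ℕ} {a : A}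
    (ha : ∀ r ∈ I ^ t, r • a = 0) : a = 0 := by
  let f : (R ⧸ I ^ t) →ₗ[R] A := Submodule.liftQ _ (LinearMap.toSpanSingleton R A a) (by
    intro r hr; simpa using ha r hr)
  obtain ⟨s, hs, hx⟩ := h t (Abelian.Ext.mk₀ (ModuleCat.ofHom f))
  rw [Abelian.Ext.mk₀_comp_mk₀, Abelian.Ext.mk₀_eq_zero_iff] at hx
  have := congrArg (fun q => q.hom (Ideal.Quotient.mk _ 1)) hx
  have h2 : f (Ideal.Quotient.mk _ 1) = 0 := this
  have h3 : f (Ideal.Quotient.mk _ 1) = (1 : R) • a := rfl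
  rw [h3, one_smul] at h2
  exact h2

/-- Every class is killed by a power of `r`. If `r ^ (k + 1)` kills `e`, then `r ^ k • e` dies in
the copy of `A` given by multiplication by `r`, so it comes from degree `i - 1` of `A/rA` and dies
further on. This removes the factors `r` one by one. -/
lemma LocalCohomologyVanishes.of_isSMulRegular {r : R} (hr : r ∈ I) (hreg : IsSMulRegular A r)
    {i : ℕ} (hC : ∀ j, j + 1 = i → LocalCohomologyVanishes I j (QuotSMulTop r A)) :
    LocalCohomologyVanishes I i A := by
  intro t e
  have key : ∀ k : ℕ, ∀ (t : ℕ)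
      (e : Abelian.Ext.{u} (ModuleCat.of R (R ⧸ I ^ t)) (ModuleCat.of R A) i), r ^ k • e = 0 →
      ∃ (s : ℕ) (h : t ≤ s), (Abelian.Ext.mk₀ (quotPowMap I h)).comp e (zero_add i) = 0 := by
    intro k
    induction k with
    | zero => exact fun t e he => ⟨t, le_rfl, by rw [pow_zero, one_smul] at he; simp [he]⟩
    | succ k ih =>
      intro t e he
      have hex : Function.Exact (LinearMap.lsmul R A r) (Submodule.mkQ (r • (⊤ : Submodule R A))) := by
        intro x
        rw [Submodule.mkQ_apply, Submodule.Quotient.mk_eq_zero, Submodule.mem_smul_pointwise_iff_exists]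
        simp
      obtain ⟨s, hs, hx⟩ := exists_quotPowMap_comp_eq_zero
        (f := LinearMap.lsmul R A r) (g := Submodule.mkQ (r • (⊤ : Submodule R A))) hreg hex
        (Submodule.mkQ_surjective _) hC (r ^ k • e) (by
          rw [← he, pow_succ', mul_smul, smul_ext_eq_comp (r := r)]; rfl)
      rw [Abelian.Ext.comp_smul] at hx
      obtain ⟨s', hs', hx'⟩ := ih s _ hx
      refine ⟨s', hs.trans hs', ?_⟩
      rw [← quotPowMap_comp hs hs', ← Abelian.Ext.mk₀_comp_mk₀,
        Abelian.Ext.comp_assoc (a₁₂ := 0) (a₂₃ := i) _ _ _ (by omega) (by omega) (by omega)]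
      exact hx'
  exact key t t e (pow_smul_ext_eq_zero hr e)

end LocalCohomology

lemma LocalCohomologyVanishes.of_isWeaklyRegular {R : Type u} [CommRing R] {I : Ideal R}
    {rs : List R} : ∀ {A : Type u} [AddCommGroup A] [Module R A], (∀ r ∈ rs, r ∈ I) →
    RingTheory.Sequence.IsWeaklyRegular A rs → ∀ {i : ℕ}, i < rs.length →
    LocalCohomologyVanishes I i A := by
  induction rs with
  | nil => intro A _ _ _ _ i hi; simp at hi
  | cons r rs ih =>
    intro A _ _ hI hreg i hi
    rw [RingTheory.Sequence.isWeaklyRegular_cons_iff] at hreg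
    refine LocalCohomologyVanishes.of_isSMulRegular (hI r (by simp)) hreg.1 fun j hj => ?_
    exact ih (fun x hx => hI x (by simp [hx])) hreg.2 (by simp at hi; omega)

end BigradedCM

/-! ### Torsion modules have no higher local cohomology -/

namespace BigradedCM

open CategoryTheory Limits Opposite

/-- Every element of `X` is killed by a power of `J`. -/
def IsPowerTorsion {R : Type*} [CommRing R] (J : Ideal R) (X : Type*) [AddCommGroup X]
    [Module R X] : Prop :=
  ∀ x : X, ∃ k : ℕ, ∀ r ∈ J ^ k, r • x = 0

/-- Dimension shifting: naturality of the extension class carries vanishing on the left-hand terms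
to vanishing one degree higher on the right-hand terms. -/
lemma mk₀_comp_extClass_comp_eq_zero {R : Type u} [CommRing R]
    {S S' : ShortComplex (ModuleCat.{u} R)} (hS : S.ShortExact) (hS' : S'.ShortExact) (φ : S' ⟶ S)
    {Y : ModuleCat.{u} R} {j : ℕ} (e : Abelian.Ext.{u} S.X₁ Y j)
    (he : (Abelian.Ext.mk₀ φ.τ₁).comp e (zero_add j) = 0) :
    (Abelian.Ext.mk₀ φ.τ₃).comp (hS.extClass.comp e (add_comm 1 j)) (zero_add (j + 1)) = 0 := by
  rw [← Abelian.Ext.comp_assoc (a₁₂ := 1) (a₂₃ := j + 1) _ _ _ (by omega) (by omega) (by omega),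
    ← ShortComplex.ShortExact.extClass_naturality hS' hS φ,
    Abelian.Ext.comp_assoc (a₁₂ := 1) (a₂₃ := j) _ _ _ (by omega) (by omega) (by omega), he,
    Abelian.Ext.comp_zero]

section Torsion

variable {R : Type u} [CommRing R] {I : Ideal R}

lemma IsPowerTorsion.exists_pow_smul_le_ker {X : Type*} [AddCommGroup X] [Module R X]
    (hX : IsPowerTorsion I X) {L : Type*} [AddCommGroup L] [Module R L] [Module.Finite R L]
    (f : L →ₗ[R] X) : ∃ s : ℕ, I ^ s • (⊤ : Submodule R L) ≤ LinearMap.ker f := by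
  obtain ⟨S, hS⟩ := Module.Finite.fg_top (R := R) (M := L)
  choose k hk using hX
  refine ⟨S.sup fun l => k (f l), ?_⟩
  rw [← hS, Submodule.smul_le]
  intro r hr n hn
  rw [LinearMap.mem_ker, map_smul]
  induction hn using Submodule.span_induction with
  | mem l hl =>
    exact hk _ r (Ideal.pow_le_pow_right (Finset.le_sup (f := fun l => k (f l)) hl) hr)
  | zero => simp
  | add x y _ _ hx hy => rw [map_add, smul_add, hx, hy, add_zero]
  | smul a x _ hx => rw [map_smul, smul_comm, hx, smul_zero]

variable [IsNoetherianRing R]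

/-- In degree `0` a map from a finite module to a torsion module kills some `I ^ s L`. Higher
degrees shift along a free presentation, with Artin–Rees controlling the kernels. -/
lemma IsPowerTorsion.exists_ext_restrict_eq_zero {X : Type u} [AddCommGroup X] [Module R X]
    (hX : IsPowerTorsion I X) (j : ℕ) : ∀ {L : Type u} [AddCommGroup L] [Module R L]
      [Module.Finite R L] (e : Abelian.Ext.{u} (ModuleCat.of R L) (ModuleCat.of R X) j),
      ∃ s : ℕ, ∀ {N : Type u} [AddCommGroup N] [Module R N] (g : N →ₗ[R] L),
        LinearMap.range g ≤ I ^ s • (⊤ : Submodule R L) →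
        (Abelian.Ext.mk₀ (ModuleCat.ofHom g)).comp e (zero_add j) = 0 := by
  induction j with
  | zero =>
    intro L _ _ _ e
    obtain ⟨f, rfl⟩ := (Abelian.Ext.mk₀_bijective _ _).2 e
    obtain ⟨s, hs⟩ := hX.exists_pow_smul_le_ker f.hom
    refine ⟨s, fun g hg => ?_⟩
    rw [Abelian.Ext.mk₀_comp_mk₀, Abelian.Ext.mk₀_eq_zero_iff]
    refine ModuleCat.hom_ext (LinearMap.ext fun x => ?_)
    exact hs (hg ⟨x, rfl⟩)
  | succ j ih =>
    intro L _ _ _ e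
    obtain ⟨n, p, hp⟩ := Module.Finite.exists_fin' R L
    have hS := LinearMap.shortExact_shortComplexKer (M := Fin n → R) (N := L) hp
    obtain ⟨e', rfl⟩ := precomp_extClass_surjective_of_projective_X₂ (ModuleCat.of R X) hS j e
    obtain ⟨s, hs⟩ := ih (L := LinearMap.ker p) e'
    -- Artin–Rees: `I^(s+k) R^n ∩ ker p = I^s (I^k R^n ∩ ker p) ⊆ I^s ker p`. The kernel over
    -- `I^(s+k) L` thus lands where `e'` already vanishes.
    obtain ⟨k, hk⟩ := I.exists_pow_inf_eq_pow_smul (LinearMap.ker p)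
    refine ⟨s + k, fun {N} _ _ g hg => ?_⟩
    have hpmap : ∀ x ∈ I ^ (s + k) • (⊤ : Submodule R (Fin n → R)),
        p x ∈ I ^ (s + k) • (⊤ : Submodule R L) := fun x hx => by
      have := Submodule.mem_map_of_mem (f := p) hx
      rw [Submodule.map_smul''] at this
      exact Submodule.smul_mono le_rfl le_top this
    obtain ⟨q, hqv⟩ : ∃ q : ↥(I ^ (s + k) • (⊤ : Submodule R (Fin n → R))) →ₗ[R]
        ↥(I ^ (s + k) • (⊤ : Submodule R L)), ∀ x, (q x : L) = p x :=
      ⟨p.restrict hpmap, fun _ => rfl⟩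
    have hq : Function.Surjective q := by
      rintro ⟨y, hy⟩
      have : y ∈ Submodule.map p (I ^ (s + k) • ⊤) := by
        rw [Submodule.map_smul'', Submodule.map_top, LinearMap.range_eq_top.2 hp]
        exact hy
      obtain ⟨x, hx, rfl⟩ := this
      exact ⟨⟨x, hx⟩, Subtype.ext (hqv _)⟩
    have hS' := LinearMap.shortExact_shortComplexKer hq
    obtain ⟨τ, hτv⟩ : ∃ τ : LinearMap.ker q →ₗ[R] LinearMap.ker p,
        ∀ x, (τ x : Fin n → R) = x.1 :=
      ⟨LinearMap.codRestrict _ ((Submodule.subtype _) ∘ₗ (LinearMap.ker q).subtype) fun x => by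
        rw [LinearMap.mem_ker]
        change p x.1.1 = 0
        rw [← hqv, x.2]
        rfl, fun _ => rfl⟩
    have hτ : LinearMap.range τ ≤ I ^ s • (⊤ : Submodule R (LinearMap.ker p)) := by
      rintro _ ⟨x, rfl⟩
      have h1 : (x.1.1 : Fin n → R) ∈ I ^ (s + k) • ⊤ ⊓ LinearMap.ker p :=
        ⟨x.1.2, by rw [← hτv]; exact (τ x).2⟩
      rw [hk _ (by omega), Nat.add_sub_cancel] at h1
      have h2 := Submodule.smul_mono (le_refl (I ^ s))
        (inf_le_right : I ^ k • ⊤ ⊓ LinearMap.ker p ≤ LinearMap.ker p) h1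
      rw [← (LinearMap.ker p).range_subtype, ← Submodule.map_top, ← Submodule.map_smul''] at h2
      obtain ⟨y, hy, hyx⟩ := h2
      have : y = τ x := Subtype.ext (hyx.trans (hτv x).symm)
      rwa [← this]
    have hz := hs (N := LinearMap.ker q) τ hτ
    let φ : q.shortComplexKer ⟶ p.shortComplexKer :=
      { τ₁ := ModuleCat.ofHom τ
        τ₂ := ModuleCat.ofHom (Submodule.subtype _)
        τ₃ := ModuleCat.ofHom (Submodule.subtype _)
        comm₁₂ := ModuleCat.hom_ext (LinearMap.ext hτv)
        comm₂₃ := ModuleCat.hom_ext (LinearMap.ext fun x => (hqv x).symm) }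
    have hsub := mk₀_comp_extClass_comp_eq_zero hS hS' φ e' hz
    let g' := g.codRestrict _ (fun x => hg ⟨x, rfl⟩)
    have hg' : ModuleCat.ofHom g = ModuleCat.ofHom g' ≫ φ.τ₃ := rfl
    rw [hg', ← Abelian.Ext.mk₀_comp_mk₀,
      Abelian.Ext.comp_assoc (a₁₂ := 0) (a₂₃ := j + 1) _ _ _ (by omega) (by omega) (by omega)]
    exact (congrArg (fun y => (Abelian.Ext.mk₀ (ModuleCat.ofHom g')).comp y
      (zero_add (j + 1))) hsub).trans (Abelian.Ext.comp_zero _ _ _ _ _)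

/-- Shifting along `0 → I^t → R → R/I^t → 0` turns the class into one on `I^t`, which dies on
`I^(t+s) = I^s I^t` by `exists_ext_restrict_eq_zero`. -/
lemma IsPowerTorsion.vanishes {X : Type u} [AddCommGroup X] [Module R X]
    (hX : IsPowerTorsion I X) {i : ℕ} (hi : 0 < i) : LocalCohomologyVanishes I i X := by
  obtain ⟨j, rfl⟩ := Nat.exists_eq_succ_of_ne_zero hi.ne'
  intro t e
  have hS : ∀ t, (exactShortComplex (I ^ t).subtype (Submodule.mkQ (I ^ t))
      (LinearMap.exact_subtype_mkQ _)).ShortExact := fun t =>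
    exactShortComplex_shortExact (Submodule.subtype_injective _) (LinearMap.exact_subtype_mkQ _)
      (Submodule.mkQ_surjective _)
  obtain ⟨e', rfl⟩ := precomp_extClass_surjective_of_projective_X₂ (ModuleCat.of R X) (hS t) j e
  obtain ⟨s, hs⟩ := hX.exists_ext_restrict_eq_zero j (L := ↥(I ^ t)) e'
  refine ⟨t + s, by omega, ?_⟩
  let τ : ↥(I ^ (t + s)) →ₗ[R] ↥(I ^ t) :=
    Submodule.inclusion (Ideal.pow_le_pow_right (by omega))
  have hτ : LinearMap.range τ ≤ I ^ s • (⊤ : Submodule R ↥(I ^ t)) := by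
    rintro _ ⟨x, rfl⟩
    have h1 : (x : R) ∈ I ^ s • (I ^ t : Ideal R) := by
      rw [smul_eq_mul, mul_comm, ← pow_add]
      exact x.2
    rw [← (I ^ t).range_subtype, ← Submodule.map_top, ← Submodule.map_smul''] at h1
    obtain ⟨y, hy, hyx⟩ := h1
    have : y = τ x := Subtype.ext hyx
    rwa [← this]
  let φ : (exactShortComplex (I ^ (t + s)).subtype (Submodule.mkQ (I ^ (t + s)))
      (LinearMap.exact_subtype_mkQ _)) ⟶ (exactShortComplex (I ^ t).subtype (Submodule.mkQ (I ^ t))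
      (LinearMap.exact_subtype_mkQ _)) :=
      { τ₁ := ModuleCat.ofHom τ
        τ₂ := 𝟙 _
        τ₃ := quotPowMap I (by omega)
        comm₁₂ := rfl
        comm₂₃ := rfl }
  exact mk₀_comp_extClass_comp_eq_zero (hS t) (hS (t + s)) φ e' (hs τ hτ)

end Torsion
end BigradedCM

/-! ### Inverting generators one at a time; the top Čech limit -/

namespace BigradedCM

section Arithmetic

variable {R : Type u} [CommRing R]

/-- The cokernel of the localization map `X → X_z`. -/
abbrev LocalizationCokernel (z : R) (X : Type u) [AddCommGroup X] [Module R X] : Type u :=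
  LocalizedModule (Submonoid.powers z) X ⧸
    LinearMap.range (LocalizedModule.mkLinearMap (Submonoid.powers z) X)

variable {I J : Ideal R} {X : Type u} [AddCommGroup X] [Module R X]

lemma mem_pow_sup_span_singleton_smul {Y : Type*} [AddCommGroup Y] [Module R Y] {z : R} {k n : ℕ}
    {x : Y} (hJ : ∀ r ∈ J ^ k, r • x = 0) (hz : z ^ n • x = 0) :
    ∀ r ∈ (J ⊔ Ideal.span {z}) ^ (k + n), r • x = 0 := by
  intro r hr
  have h := Ideal.sup_pow_add_le_pow_sup_pow hr
  rw [Ideal.span_singleton_pow] at h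
  obtain ⟨a, ha, b, hb, rfl⟩ := Submodule.mem_sup.1 h
  obtain ⟨c, rfl⟩ := Ideal.mem_span_singleton'.1 hb
  rw [add_smul, hJ a ha, mul_smul, hz, smul_zero, add_zero]

lemma IsPowerTorsion.ker_localization (hX : IsPowerTorsion J X) (z : R) :
    IsPowerTorsion (J ⊔ Ideal.span {z})
      (LinearMap.ker (LocalizedModule.mkLinearMap (Submonoid.powers z) X)) := by
  rintro ⟨x, hx⟩
  obtain ⟨k, hk⟩ := hX x
  have hx' : LocalizedModule.mkLinearMap (Submonoid.powers z) X x = 0 := hx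
  obtain ⟨⟨_, n, rfl⟩, hn⟩ := (IsLocalizedModule.eq_zero_iff (Submonoid.powers z)
    (LocalizedModule.mkLinearMap (Submonoid.powers z) X)).1 hx'
  refine ⟨k + n, fun r hr => Subtype.ext ?_⟩
  exact mem_pow_sup_span_singleton_smul hk hn r hr

/-- Some `z ^ n • y` is the image of an `x` in `X`. A power of `J` killing `x` kills `y`, since `z ^
n` is injective on `X_z`, and `z ^ n` kills `y` in the cokernel. -/
lemma IsPowerTorsion.localizationCokernel (hX : IsPowerTorsion J X) (z : R) :
    IsPowerTorsion (J ⊔ Ideal.span {z}) (LocalizationCokernel z X) := by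
  intro y
  obtain ⟨y, rfl⟩ := Submodule.mkQ_surjective _ y
  obtain ⟨⟨x, ⟨_, n, rfl⟩⟩, hx⟩ := IsLocalizedModule.surj (Submonoid.powers z)
    (LocalizedModule.mkLinearMap (Submonoid.powers z) X) y
  obtain ⟨k, hk⟩ := hX x
  refine ⟨k + n, mem_pow_sup_span_singleton_smul (fun r hr => ?_) ?_⟩
  · have : r • y = 0 := by
      have h1 : (⟨z ^ n, n, rfl⟩ : Submonoid.powers z) • (r • y) = 0 := by
        rw [smul_comm, hx, ← map_smul, hk r hr, map_zero]
      refine IsLocalizedModule.smul_injective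
        (LocalizedModule.mkLinearMap (Submonoid.powers z) X) (⟨z ^ n, n, rfl⟩ : Submonoid.powers z) ?_
      exact h1.trans (smul_zero _).symm
    rw [← map_smul, this, map_zero]
  · rw [← map_smul, Submodule.mkQ_apply, Submodule.Quotient.mk_eq_zero]
    exact ⟨x, hx.symm⟩

lemma vanishes_localizedModule {z : R} (hz : z ∈ I) (i : ℕ) :
    LocalCohomologyVanishes I i (LocalizedModule (Submonoid.powers z) X) := by
  refine LocalCohomologyVanishes.of_bijective hz ⟨fun a b h => ?_, fun a => ?_⟩ i
  · exact IsLocalizedModule.smul_injective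
        (LocalizedModule.mkLinearMap (Submonoid.powers z) X) (⟨z, Submonoid.mem_powers z⟩ : Submonoid.powers z) h
  · obtain ⟨b, hb⟩ := ((Module.End.isUnit_iff _).1 (IsLocalizedModule.map_units
      (LocalizedModule.mkLinearMap (Submonoid.powers z) X) ⟨z, Submonoid.mem_powers z⟩)).2 a
    exact ⟨b, hb⟩

/-- `X_z` has no local cohomology, so that of the image of `X` in `X_z` is that of the cokernel
shifted by one degree. -/
lemma vanishes_of_ker_of_localizationCokernel {z : R} (hz : z ∈ I) {i : ℕ}
    (hK : LocalCohomologyVanishes I i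
      (LinearMap.ker (LocalizedModule.mkLinearMap (Submonoid.powers z) X)))
    (hC : ∀ j, j + 1 = i → LocalCohomologyVanishes I j (LocalizationCokernel z X)) :
    LocalCohomologyVanishes I i X := by
  let f := LocalizedModule.mkLinearMap (Submonoid.powers z) X
  have hr : LocalCohomologyVanishes I i (LinearMap.range f) :=
    LocalCohomologyVanishes.of_exact_left (f := (LinearMap.range f).subtype)
      (g := (LinearMap.range f).mkQ) (Submodule.subtype_injective _)
      (LinearMap.exact_subtype_mkQ _) (Submodule.mkQ_surjective _) (vanishes_localizedModule hz i) hC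
  exact LocalCohomologyVanishes.of_exact_middle (f := (LinearMap.ker f).subtype)
    (g := f.rangeRestrict) (Submodule.subtype_injective _)
    (by rw [LinearMap.exact_iff, LinearMap.ker_rangeRestrict, Submodule.range_subtype])
    f.surjective_rangeRestrict hK hr

lemma vanishes_localizationCokernel {z : R} (hz : z ∈ I) {i : ℕ}
    (hK : LocalCohomologyVanishes I (i + 2)
      (LinearMap.ker (LocalizedModule.mkLinearMap (Submonoid.powers z) X)))
    (hX : LocalCohomologyVanishes I (i + 1) X) :
    LocalCohomologyVanishes I i (LocalizationCokernel z X) := by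
  let f := LocalizedModule.mkLinearMap (Submonoid.powers z) X
  have hr : LocalCohomologyVanishes I (i + 1) (LinearMap.range f) :=
    LocalCohomologyVanishes.of_exact_right (f := (LinearMap.ker f).subtype)
      (g := f.rangeRestrict) (Submodule.subtype_injective _)
      (by rw [LinearMap.exact_iff, LinearMap.ker_rangeRestrict, Submodule.range_subtype])
      f.surjective_rangeRestrict hX hK
  exact LocalCohomologyVanishes.of_exact_right (f := (LinearMap.range f).subtype)
      (g := (LinearMap.range f).mkQ) (Submodule.subtype_injective _)
      (LinearMap.exact_subtype_mkQ _) (Submodule.mkQ_surjective _) (vanishes_localizedModule hz i) hr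

lemma sup_span_cons (J : Ideal R) (z : R) (zs : List R) :
    J ⊔ Ideal.span {x | x ∈ z :: zs} = J ⊔ Ideal.span {z} ⊔ Ideal.span {x | x ∈ zs} := by
  rw [sup_assoc, ← Ideal.span_union]
  congr 2
  ext; simp

variable [IsNoetherianRing R]

lemma IsPowerTorsion.of_le_radical (hX : IsPowerTorsion J X) (h : I ≤ J.radical) :
    IsPowerTorsion I X := by
  obtain ⟨m, hm⟩ := Ideal.exists_pow_le_of_le_radical_of_fg h (IsNoetherian.noetherian I)
  intro x
  obtain ⟨k, hk⟩ := hX x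
  refine ⟨m * k, fun r hr => hk r ?_⟩
  rw [pow_mul] at hr
  exact Ideal.pow_right_mono hm k hr

/-- `H^i_I(X) = 0` for `i > d` if `I` is, up to radical, generated by `d` elements modulo an ideal
`J` such that `X` is `J`-torsion. -/
lemma IsPowerTorsion.vanishes_of_length_lt {zs : List R} : ∀ {J : Ideal R} {X : Type u}
    [AddCommGroup X] [Module R X], IsPowerTorsion J X → (∀ z ∈ zs, z ∈ I) →
    I ≤ (J ⊔ Ideal.span {z | z ∈ zs}).radical → ∀ {i : ℕ}, zs.length < i →
    LocalCohomologyVanishes I i X := by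
  induction zs with
  | nil =>
    intro J X _ _ hX _ hI i hi
    simp only [List.not_mem_nil, Set.ofPred_false, Ideal.span_empty, sup_bot_eq] at hI
    exact (hX.of_le_radical hI).vanishes hi
  | cons z zs ih =>
    intro J X _ _ hX hz hI i hi
    rw [sup_span_cons] at hI
    simp only [List.length_cons] at hi
    have hz' : ∀ x ∈ zs, x ∈ I := fun x hx => hz x (by simp [hx])
    -- Kernel and cokernel are torsion for `J + (z)`: the generator `z` moves from the list into the
    -- torsion ideal. The cokernel is needed one degree lower, matching the shorter list.
    exact vanishes_of_ker_of_localizationCokernel (hz z (by simp))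
      (ih (hX.ker_localization z) hz' hI (by omega))
      fun j hj => ih (hX.localizationCokernel z) hz' hI (by omega)

end Arithmetic

section Cech

variable {R : Type u} [CommRing R]

/-- The direct limit of the modules `X ⧸ (z₁ ^ t, …, z_d ^ t) X`, with transition maps given by
multiplication by `z₁ ⋯ z_d`, is zero. -/
def TopCechVanishes (zs : List R) (X : Type*) [AddCommGroup X] [Module R X] : Prop :=
  ∀ (x : X) (s : ℕ), ∃ k : ℕ, zs.prod ^ k • x ∈
    Ideal.span ((· ^ (k + s)) '' {z | z ∈ zs}) • (⊤ : Submodule R X)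

lemma prod_pow_mul_mem_span (zs : List R) (k d : ℕ) {r : R}
    (hr : r ∈ Ideal.span ((· ^ k) '' {z | z ∈ zs})) :
    zs.prod ^ d * r ∈ Ideal.span ((· ^ (k + d)) '' {z | z ∈ zs}) := by
  induction hr using Submodule.span_induction with
  | mem x hx =>
    obtain ⟨z, hz, rfl⟩ := hx
    obtain ⟨c, hc⟩ := List.dvd_prod hz
    have : zs.prod ^ d * z ^ k = c ^ d * z ^ (k + d) := by rw [hc]; ring
    simp only [this]
    exact Ideal.mul_mem_left _ _ (Ideal.subset_span ⟨z, hz, rfl⟩)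
  | zero => simp
  | add x y _ _ hx hy => rw [mul_add]; exact add_mem hx hy
  | smul a x _ hx => rw [smul_eq_mul, mul_left_comm]; exact Ideal.mul_mem_left _ _ hx

lemma prod_pow_smul_mem (zs : List R) (k d : ℕ) {X : Type*} [AddCommGroup X] [Module R X] {x : X}
    (hx : x ∈ Ideal.span ((· ^ k) '' {z | z ∈ zs}) • (⊤ : Submodule R X)) :
    zs.prod ^ d • x ∈ Ideal.span ((· ^ (k + d)) '' {z | z ∈ zs}) • (⊤ : Submodule R X) := by
  induction hx using Submodule.smul_induction_on' with
  | smul r hr n hn =>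
    rw [← mul_smul]
    exact Submodule.smul_mem_smul (prod_pow_mul_mem_span zs k d hr) trivial
  | add x _ y _ hx hy => rw [smul_add]; exact add_mem hx hy

/-- Denominators are cleared without leaving the multiples of `𝔞`. All large exponents are allowed
so that sums can use a common one. -/
lemma exists_pow_smul_mem_map {X : Type u} [AddCommGroup X] [Module R X] (z : R) (𝔞 : Ideal R)
    {w : LocalizedModule (Submonoid.powers z) X}
    (hw : w ∈ 𝔞 • (⊤ : Submodule R (LocalizedModule (Submonoid.powers z) X))) :
    ∃ m, ∀ m' ≥ m, ∃ x ∈ 𝔞 • (⊤ : Submodule R X),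
      LocalizedModule.mkLinearMap (Submonoid.powers z) X x = z ^ m' • w := by
  induction hw using Submodule.smul_induction_on' with
  | smul r hr n _ =>
    obtain ⟨⟨x, ⟨_, m, rfl⟩⟩, hx⟩ := IsLocalizedModule.surj (Submonoid.powers z)
      (LocalizedModule.mkLinearMap (Submonoid.powers z) X) n
    refine ⟨m, fun m' hm' => ⟨r • z ^ (m' - m) • x, Submodule.smul_mem_smul hr trivial, ?_⟩⟩
    have hx' : z ^ m • n = LocalizedModule.mkLinearMap (Submonoid.powers z) X x := hx
    rw [map_smul, map_smul, ← hx', smul_smul (z ^ (m' - m)), ← pow_add, Nat.sub_add_cancel hm',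
      smul_comm]
  | add x _ y _ hx hy =>
    obtain ⟨m, hm⟩ := hx
    obtain ⟨n, hn⟩ := hy
    refine ⟨max m n, fun m' hm' => ?_⟩
    obtain ⟨a, ha, ha'⟩ := hm m' (le_trans (le_max_left _ _) hm')
    obtain ⟨b, hb, hb'⟩ := hn m' (le_trans (le_max_right _ _) hm')
    exact ⟨a + b, add_mem ha hb, by rw [map_add, ha', hb', smul_add]⟩

/-- The hypothesis for the class of the fraction `x / z^s` writes `(∏ zs)^k x / z^s` as an element
of `𝔞 X_z` plus the image of some `x₀`. After clearing denominators the first part is a combination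
of powers from `zs`, and the second is a multiple of the required power of `z`. -/
lemma TopCechVanishes.cons {X : Type u} [AddCommGroup X] [Module R X] {z : R} {zs : List R}
    (h : TopCechVanishes zs (LocalizationCokernel z X)) : TopCechVanishes (z :: zs) X := by
  intro x s
  let f := LocalizedModule.mkLinearMap (Submonoid.powers z) X
  let y : LocalizedModule (Submonoid.powers z) X :=
    LocalizedModule.mk x (⟨z ^ s, s, rfl⟩ : Submonoid.powers z)
  have hy : z ^ s • y = f x := by
    change (⟨z ^ s, s, rfl⟩ : Submonoid.powers z) • y = f x
    simp only [y, f, LocalizedModule.mkLinearMap_apply]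
    exact LocalizedModule.smul'_mk _ _ _ |>.trans (LocalizedModule.mk_cancel _ _)
  obtain ⟨k, hk⟩ := h (Submodule.mkQ _ y) s
  set 𝔞 := Ideal.span ((· ^ (k + s)) '' {z | z ∈ zs}) with h𝔞
  have hk' : (LinearMap.range f).mkQ (zs.prod ^ k • y) ∈
      Submodule.map (LinearMap.range f).mkQ (𝔞 • ⊤) := by
    rw [Submodule.map_smul'', Submodule.map_top, Submodule.range_mkQ, map_smul]
    exact hk
  obtain ⟨w, hw, hwy⟩ := hk'
  have h1 : zs.prod ^ k • y - w ∈ LinearMap.range f := by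
    rw [← Submodule.Quotient.mk_eq_zero, Submodule.Quotient.mk_sub]
    exact sub_eq_zero.2 hwy.symm
  obtain ⟨x₀, hx₀⟩ := h1
  obtain ⟨m₀, hm₀⟩ := exists_pow_smul_mem_map z 𝔞 hw
  obtain ⟨m, hm, hmk⟩ : ∃ m, m₀ ≤ m ∧ s + k ≤ m := ⟨max m₀ (s + k), le_max_left _ _, le_max_right _ _⟩
  obtain ⟨w', hw', hfw⟩ := hm₀ m hm
  have h2 : f (zs.prod ^ k • z ^ (m - s) • x) = f (w' + z ^ m • x₀) := by
    rw [map_add, map_smul, map_smul, map_smul, hfw, hx₀, ← hy, smul_smul (z ^ (m - s)), ← pow_add,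
      Nat.sub_add_cancel (by omega), smul_sub, smul_comm]
    abel
  obtain ⟨⟨_, l, rfl⟩, hl⟩ := (IsLocalizedModule.eq_iff_exists (Submonoid.powers z) f).1 h2
  have hl' : z ^ l • (zs.prod ^ k • z ^ (m - s) • x) = z ^ l • (w' + z ^ m • x₀) := hl
  -- This choice makes `m + l = k + d + s`, precisely the power of `z` that multiplies `x₀`.
  obtain ⟨d, hd⟩ : ∃ d, m + l - s = k + d := ⟨m + l - s - k, by omega⟩
  refine ⟨k + d, ?_⟩
  have h3 : (z :: zs).prod ^ (k + d) • x =
      z ^ l • zs.prod ^ d • w' + z ^ (k + d + s) • zs.prod ^ d • x₀ := by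
    have e1 : (z :: zs).prod ^ (k + d) • x =
        zs.prod ^ d • (z ^ l • (zs.prod ^ k • z ^ (m - s) • x)) := by
      simp only [smul_smul, List.prod_cons]
      congr 1
      have : k + d = l + (m - s) := by omega
      rw [mul_pow, pow_add zs.prod, this, pow_add z]
      ring
    rw [e1, hl']
    have : k + d + s = l + m := by omega
    rw [this]
    simp only [smul_add, smul_smul]
    congr 2
    · ring
    · ring
  rw [h3]
  refine add_mem (Submodule.smul_mem _ _ ?_) ?_
  · refine Submodule.smul_mono (Ideal.span_mono (Set.image_mono fun a ha => by simp_all)) le_rfl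
      (?_ : _ ∈ Ideal.span ((· ^ (k + d + s)) '' {z | z ∈ zs}) • (⊤ : Submodule R X))
    have := prod_pow_smul_mem zs (k + s) d hw'
    rwa [show k + d + s = k + s + d by ring]
  · exact Submodule.smul_mem_smul (Ideal.subset_span ⟨z, by simp, rfl⟩) trivial

variable [IsNoetherianRing R]

/-- The induction of `vanishes_of_length_lt` at the boundary degree: for a list of length `d > 0`
the kernel has no cohomology in degree `d + 1`, so vanishing passes from degree `d` of `X` to degree
`d - 1` of the cokernel. -/
lemma IsPowerTorsion.topCechVanishes {I : Ideal R} {zs : List R} : ∀ {J : Ideal R} {X : Type u}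
    [AddCommGroup X] [Module R X], IsPowerTorsion J X → (∀ z ∈ zs, z ∈ I) →
    I ≤ (J ⊔ Ideal.span {z | z ∈ zs}).radical → LocalCohomologyVanishes I zs.length X →
    TopCechVanishes zs X := by
  induction zs with
  | nil =>
    intro J X _ _ hX _ hI hv x s
    simp only [List.not_mem_nil, Set.ofPred_false, Ideal.span_empty, sup_bot_eq] at hI
    obtain ⟨t, ht⟩ := hX.of_le_radical hI x
    exact ⟨0, by simp [eq_zero_of_vanishes_zero hv ht]⟩
  | cons z zs ih =>
    intro J X _ _ hX hz hI hv
    rw [sup_span_cons] at hI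
    have hz' : ∀ x ∈ zs, x ∈ I := fun x hx => hz x (by simp [hx])
    refine TopCechVanishes.cons (ih (hX.localizationCokernel z) hz' hI ?_)
    refine vanishes_localizationCokernel (hz z (by simp)) ?_ hv
    exact (hX.ker_localization z).vanishes_of_length_lt hz' hI (by omega)

end Cech

end BigradedCM

/-! ### Prime avoidance and a grade estimate -/

namespace BigradedCM

open scoped Pointwise

section

variable {R : Type u} [CommRing R]

/-- Prime avoidance for the coset `x + J`. -/
lemma exists_add_notMem_of_finset (x : R) (J : Ideal R) (n : ℕ) : ∀ s : Finset (Ideal R),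
    s.card = n → (∀ p ∈ s, p.IsPrime) → (∀ p ∈ s, x ∈ p → ¬ J ≤ p) →
    ∃ j ∈ J, ∀ p ∈ s, x + j ∉ p := by
  classical
  induction n with
  | zero =>
    intro s hs _ _
    rw [Finset.card_eq_zero] at hs
    exact ⟨0, J.zero_mem, by simp [hs]⟩
  | succ n ih =>
    intro s hs hp hJ
    -- For minimal `q` no other prime of `s` lies inside `q`. So `J` meets the intersection of the
    -- others outside `q`, and adding such an element repairs membership in `q` without disturbing
    -- the rest.
    obtain ⟨q, hq, hmin⟩ := s.exists_minimal (Finset.card_pos.1 (by omega))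
    obtain ⟨j, hj, hjs⟩ := ih (s.erase q) (by rw [Finset.card_erase_of_mem hq]; omega)
      (fun p h => hp p (Finset.mem_of_mem_erase h)) (fun p h => hJ p (Finset.mem_of_mem_erase h))
    by_cases hxq : x + j ∈ q
    · have hqp := hp q hq
      have hJq : ¬ J ≤ q := fun h => hJ q hq ((Submodule.add_mem_iff_left _ (h hj)).1 hxq) h
      have hle : ¬ J ⊓ (s.erase q).inf id ≤ q := by
        intro h
        rcases (hqp.inf_le).1 h with h | h
        · exact hJq h
        · obtain ⟨p, hps, hpq⟩ := (hqp.inf_le').1 h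
          have := hmin (Finset.mem_of_mem_erase hps) hpq
          exact Finset.ne_of_mem_erase hps (le_antisymm hpq this)
      obtain ⟨v, hv, hvq⟩ := SetLike.not_le_iff_exists.1 hle
      refine ⟨j + v, add_mem hj hv.1, fun p hps => ?_⟩
      rw [← add_assoc]
      by_cases hpq : p = q
      · subst hpq
        exact fun h => hvq ((Submodule.add_mem_iff_right _ hxq).1 h)
      · have hps' := Finset.mem_erase.2 ⟨hpq, hps⟩
        have hvp : v ∈ p := (Finset.inf_le (f := id) hps' : _ ≤ p) hv.2
        exact fun h => hjs p hps' ((Submodule.add_mem_iff_left _ hvp).1 h)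
    · refine ⟨j, hj, fun p hps => ?_⟩
      by_cases hpq : p = q
      · exact hpq ▸ hxq
      · exact hjs p (Finset.mem_erase.2 ⟨hpq, hps⟩)

lemma LocalCohomologyVanishes.quotSMulTop {I : Ideal R} {M : Type u} [AddCommGroup M] [Module R M]
    {w : R} (hw : IsSMulRegular M w) {i : ℕ} (h : LocalCohomologyVanishes I i M)
    (h' : LocalCohomologyVanishes I (i + 1) M) :
    LocalCohomologyVanishes I i (QuotSMulTop w M) := by
  have hex : Function.Exact (LinearMap.lsmul R M w) (Submodule.mkQ (w • (⊤ : Submodule R M))) := by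
    intro x
    rw [Submodule.mkQ_apply, Submodule.Quotient.mk_eq_zero, Submodule.mem_smul_pointwise_iff_exists]
    simp
  exact LocalCohomologyVanishes.of_exact_right (f := LinearMap.lsmul R M w)
    (g := Submodule.mkQ (w • (⊤ : Submodule R M))) hw hex (Submodule.mkQ_surjective _) h h'

/-- If `H^i_I(M) = 0` for `i ≤ d` and `I` is, up to radical, generated by `d` elements modulo `𝔞`,
then `0 :_M 𝔞` vanishes near `V(I)`. -/
lemma exists_sub_one_mem_smul_eq_zero [IsNoetherianRing R] {I : Ideal R} {zs : List R} :
    ∀ {𝔞 : Ideal R} {M : Type u} [AddCommGroup M] [Module R M] [Module.Finite R M],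
    (∀ z ∈ zs, z ∈ I) → I ≤ (𝔞 ⊔ Ideal.span {z | z ∈ zs}).radical →
    (∀ i ≤ zs.length, LocalCohomologyVanishes I i M) →
    ∃ s : R, s - 1 ∈ I ∧ ∀ m : M, (∀ r ∈ 𝔞, r • m = 0) → s • m = 0 := by
  induction zs with
  | nil =>
    intro 𝔞 M _ _ _ _ hI hv
    simp only [List.not_mem_nil, Set.ofPred_false, Ideal.span_empty, sup_bot_eq] at hI
    obtain ⟨t, ht⟩ := Ideal.exists_pow_le_of_le_radical_of_fg hI (IsNoetherian.noetherian I)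
    refine ⟨1, by simp, fun m hm => ?_⟩
    rw [one_smul]
    exact eq_zero_of_vanishes_zero (hv 0 le_rfl) fun r hr => hm r (ht hr)
  | cons z zs ih =>
    intro 𝔞 M _ _ _ hz hI hv
    have hfin := associatedPrimes.finite R M
    -- `H^0_I(M) = 0` leaves no nonzero element killed by `I`, so no associated prime contains `I`.
    have hIp : ∀ p ∈ associatedPrimes R M, ¬ I ≤ p := by
      rintro p hp hle
      obtain ⟨hpp, m, hm⟩ := isAssociatedPrime_iff.1 hp
      have : m = 0 := by
        refine eq_zero_of_vanishes_zero (hv 0 (Nat.zero_le _)) (t := 1) fun r hr => ?_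
        rw [pow_one] at hr
        have := hle hr
        rw [hm] at this
        simpa using this
      subst this
      refine hpp.ne_top ?_
      rw [hm, Ideal.eq_top_iff_one]
      simp
    -- `z` is perturbed to an `M`-regular element. An associated prime containing `z` and the
    -- perturbing ideal would contain `𝔞` and all generators, hence `I`. The product `𝔞 * I` is used
    -- instead of `𝔞` because `𝔞` need not lie in `I`.
    obtain ⟨j, hj, hjp⟩ := exists_add_notMem_of_finset z (Ideal.span {z | z ∈ zs} ⊔ 𝔞 * I) _
      hfin.toFinset rfl (fun p hp => ((Set.Finite.mem_toFinset _).1 hp).1) (by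
        intro p hp hzp hle
        rw [Set.Finite.mem_toFinset] at hp
        have hpp : p.IsPrime := hp.1
        have h𝔞 : 𝔞 ≤ p := ((hpp.mul_le).1 (le_sup_right.trans hle)).resolve_right (hIp p hp)
        refine hIp p hp (hI.trans ?_)
        rw [hpp.radical_le_iff, sup_span_cons]
        refine sup_le (sup_le h𝔞 ?_) (le_sup_left.trans hle)
        rwa [Ideal.span_singleton_le_iff_mem])
    have hz' : ∀ x ∈ zs, x ∈ I := fun x hx => hz x (by simp [hx])
    have hJI : Ideal.span {z | z ∈ zs} ⊔ 𝔞 * I ≤ I :=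
      sup_le (Ideal.span_le.2 hz') Ideal.mul_le_right
    have hwI : z + j ∈ I := add_mem (hz z (by simp)) (hJI hj)
    have hreg : IsSMulRegular M (z + j) := by
      by_contra hcon
      have : z + j ∈ ⋃ p ∈ associatedPrimes R M, (p : Set R) := by
        rw [biUnion_associatedPrimes_eq_compl_regular]
        exact hcon
      simp only [Set.mem_iUnion, exists_prop] at this
      obtain ⟨p, hp, hw⟩ := this
      exact hjp p ((Set.Finite.mem_toFinset _).2 hp) hw
    -- Passing to `M/(z+j)M` costs one degree of vanishing and one generator, while `z + j` joins
    -- `𝔞`.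
    obtain ⟨s, hs, hsm⟩ := ih (𝔞 := 𝔞 ⊔ Ideal.span {z + j}) (M := QuotSMulTop (z + j) M) hz' (by
        refine hI.trans (Ideal.radical_mono ?_)
        rw [sup_span_cons]
        refine sup_le (sup_le (le_sup_of_le_left le_sup_left) ?_) le_sup_right
        rw [Ideal.span_singleton_le_iff_mem]
        refine (Submodule.add_mem_iff_left _ (?_ : j ∈ _)).1 (?_ : z + j ∈ _)
        swap
        · exact Ideal.mem_sup_left (Ideal.mem_sup_right (Ideal.mem_span_singleton_self _))
        · have hle : Ideal.span {z | z ∈ zs} ⊔ 𝔞 * I ≤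
              𝔞 ⊔ Ideal.span {z + j} ⊔ Ideal.span {z | z ∈ zs} :=
            sup_le le_sup_right (Ideal.mul_le_left.trans (le_sup_of_le_left le_sup_left))
          exact hle hj) fun i hi =>
      (hv i (by simp; omega)).quotSMulTop hreg (hv (i + 1) (by simp; omega))
    let W : Submodule R M := Submodule.torsionBySet R M 𝔞
    have hW : ∀ m, m ∈ W ↔ ∀ r ∈ 𝔞, r • m = 0 := fun m => by
      rw [Submodule.mem_torsionBySet_iff]; simp
    -- For `m ∈ W` one gets `s m = (z + j) m'`, with `m' ∈ W` by regularity. Hence `m = (z + j) m' -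
    -- (s - 1) m` lies in `I W`, and Nakayama applies.
    have hle : W ≤ I • W := by
      intro m hm
      have hm' := (hW m).1 hm
      have h0 := hsm (Submodule.Quotient.mk m) (by
        intro r hr
        rw [← Submodule.Quotient.mk_smul, Submodule.Quotient.mk_eq_zero]
        obtain ⟨a, ha, b, hb, rfl⟩ := Submodule.mem_sup.1 hr
        obtain ⟨c, rfl⟩ := Ideal.mem_span_singleton'.1 hb
        rw [add_smul, hm' a ha, zero_add, mul_comm, mul_smul]
        exact Submodule.smul_mem_pointwise_smul _ _ _ trivial)
      rw [← Submodule.Quotient.mk_smul, Submodule.Quotient.mk_eq_zero,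
        Submodule.mem_smul_pointwise_iff_exists] at h0
      obtain ⟨m', _, hm'eq⟩ := h0
      have hm'W : m' ∈ W := by
        rw [hW]
        intro r hr
        apply hreg
        change (z + j) • r • m' = (z + j) • (0 : M)
        rw [smul_comm, hm'eq, smul_comm, hm' r hr, smul_zero, smul_zero]
      have : m = (z + j) • m' - (s - 1) • m := by
        rw [hm'eq, sub_smul, one_smul]; abel
      rw [this]
      exact sub_mem (Submodule.smul_mem_smul hwI hm'W) (Submodule.smul_mem_smul hs hm)
    obtain ⟨r, hr, hrW⟩ := Submodule.exists_sub_one_mem_and_smul_eq_zero_of_fg_of_le_smul I W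
      (IsNoetherian.noetherian W) hle
    exact ⟨r, hr, fun m hm => hrW m ((hW m).2 hm)⟩

end

end BigradedCM

/-! ### Bigraded modules and graded Nakayama for `Q` -/

namespace BigradedCM

section Graded

variable {K : Type u} [Field K] {m n : ℕ} {M : Type u} [AddCommGroup M]
  [Module (BiPoly K m n) M] (𝓜 : ℤ × ℤ → AddSubgroup M) [DirectSum.Decomposition 𝓜]

/-- The homogeneous component of degree `e`. -/
noncomputable def homComponent (e : ℤ × ℤ) : M →+ M :=
  (𝓜 e).subtype.comp ((DFinsupp.evalAddMonoidHom e).comp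
    (DirectSum.decomposeAddEquiv 𝓜).toAddMonoidHom)

lemma homComponent_apply (e : ℤ × ℤ) (x : M) :
    homComponent 𝓜 e x = (DirectSum.decompose 𝓜 x e : M) := rfl

variable {𝓜}

lemma homComponent_mem (e : ℤ × ℤ) (x : M) : homComponent 𝓜 e x ∈ 𝓜 e :=
  (DirectSum.decompose 𝓜 x e).2

lemma homComponent_of_mem {e : ℤ × ℤ} {x : M} (hx : x ∈ 𝓜 e) : homComponent 𝓜 e x = x := by
  rw [homComponent_apply, DirectSum.decompose_of_mem_same 𝓜 hx]

lemma homComponent_of_mem_ne {d e : ℤ × ℤ} {x : M} (hx : x ∈ 𝓜 d) (h : d ≠ e) :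
    homComponent 𝓜 e x = 0 := by
  rw [homComponent_apply, DirectSum.decompose_of_mem_ne 𝓜 hx h]

lemma mem_of_forall_homComponent_mem (W : AddSubgroup M) {x : M}
    (h : ∀ e, homComponent 𝓜 e x ∈ W) : x ∈ W := by
  classical
  rw [← DirectSum.sum_support_decompose 𝓜 x]
  exact AddSubgroup.sum_mem _ fun e _ => h e

lemma isHomogeneous_iff {N : Submodule (BiPoly K m n) M} :
    N.IsHomogeneous 𝓜 ↔ ∀ e, ∀ x ∈ N, homComponent 𝓜 e x ∈ N :=
  ⟨fun h e _ hx => h e hx, fun h e _ hx => h e _ hx⟩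

lemma IsHomogeneous.bot : (⊥ : Submodule (BiPoly K m n) M).IsHomogeneous 𝓜 :=
  isHomogeneous_iff.2 fun e x hx => by
    rw [Submodule.mem_bot] at hx ⊢
    rw [hx, map_zero]

lemma finite_homComponent_ne_zero (x : M) : {e | homComponent 𝓜 e x ≠ 0}.Finite := by
  classical
  refine (DFinsupp.support (DirectSum.decompose 𝓜 x)).finite_toSet.subset fun e he => ?_
  simp only [Finset.mem_coe, DFinsupp.mem_support_toFun]
  intro h
  exact he (by rw [homComponent_apply, h]; rfl)

lemma exists_finite_homogeneous_span_eq [Module.Finite (BiPoly K m n) M]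
    {N : Submodule (BiPoly K m n) M} (hN : N.IsHomogeneous 𝓜) :
    ∃ G : Set M, G.Finite ∧ (∀ g ∈ G, ∃ e, g ∈ 𝓜 e) ∧ Submodule.span (BiPoly K m n) G = N := by
  obtain ⟨S, hS⟩ := IsNoetherian.noetherian N
  refine ⟨⋃ x ∈ (S : Set M), (fun e => homComponent 𝓜 e x) '' {e | homComponent 𝓜 e x ≠ 0},
    S.finite_toSet.biUnion fun x _ => (finite_homComponent_ne_zero x).image _, ?_,
    le_antisymm ?_ ?_⟩
  · intro g hg
    obtain ⟨x, _, e, _, rfl⟩ := Set.mem_iUnion₂.1 hg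
    exact ⟨e, homComponent_mem e x⟩
  · rw [Submodule.span_le]
    intro g hg
    obtain ⟨x, hx, e, _, rfl⟩ := Set.mem_iUnion₂.1 hg
    exact isHomogeneous_iff.1 hN e x (hS ▸ Submodule.subset_span hx)
  · rw [← hS, Submodule.span_le]
    intro x hx
    refine mem_of_forall_homComponent_mem (𝓜 := 𝓜)
      (Submodule.span (BiPoly K m n) _).toAddSubgroup fun e => ?_
    by_cases he : homComponent 𝓜 e x = 0
    · rw [he]
      exact zero_mem _
    · exact Submodule.subset_span (Set.mem_iUnion₂.2 ⟨x, hx, e, he, rfl⟩)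

variable [SetLike.GradedSMul (bigrading K m n) 𝓜]

lemma smul_mem_graded {M : Type u} [AddCommGroup M] [Module (BiPoly K m n) M]
    {𝓜 : ℤ × ℤ → AddSubgroup M} [SetLike.GradedSMul (bigrading K m n) 𝓜] {d e : ℤ × ℤ} {r : BiPoly K m n} {x : M} (hr : r ∈ bigrading K m n d)
    (hx : x ∈ 𝓜 e) : r • x ∈ 𝓜 (d + e) :=
  SetLike.GradedSMul.smul_mem hr hx

lemma homComponent_smul {d : ℤ × ℤ} {r : BiPoly K m n} (hr : r ∈ bigrading K m n d) (e : ℤ × ℤ)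
    (x : M) : homComponent 𝓜 e (r • x) = r • homComponent 𝓜 (e - d) x := by
  classical
  induction x using DirectSum.Decomposition.inductionOn 𝓜 with
  | zero => simp
  | @homogeneous i x =>
    by_cases h : d + i = e
    · subst h
      rw [homComponent_of_mem (smul_mem_graded hr x.2), add_sub_cancel_left,
        homComponent_of_mem x.2]
    · rw [homComponent_of_mem_ne (smul_mem_graded hr x.2) h, homComponent_of_mem_ne x.2, smul_zero]
      rintro rfl
      exact h (by abel)
  | add x y hx hy => rw [smul_add, map_add, hx, hy, map_add, smul_add]

lemma X_mem_bigrading (v : Fin m ⊕ Fin n) :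
    (MvPolynomial.X v : BiPoly K m n) ∈ bigrading K m n (biWeight m n v) :=
  MvPolynomial.isWeightedHomogeneous_X K _ v

lemma C_mem_bigrading (c : K) : (MvPolynomial.C c : BiPoly K m n) ∈ bigrading K m n 0 :=
  MvPolynomial.isWeightedHomogeneous_C _ c

/-- Membership of the components of `r • x`, for `r` in an ideal generated by homogeneous
elements. -/
lemma homComponent_smul_mem {ι : Type*} {f : ι → BiPoly K m n} {d : ι → ℤ × ℤ}
    (hf : ∀ i, f i ∈ bigrading K m n (d i)) {N : Submodule (BiPoly K m n) M} {W : AddSubgroup M}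
    {e : ℤ × ℤ} (h : ∀ i, ∀ x ∈ N, f i • homComponent 𝓜 (e - d i) x ∈ W) {x : M}
    (hx : x ∈ Ideal.span (Set.range f) • N) : homComponent 𝓜 e x ∈ W := by
  induction hx using Submodule.smul_induction_on' with
  | smul r hr x hx =>
    induction hr using Submodule.span_induction generalizing x with
    | mem r hr =>
      obtain ⟨i, rfl⟩ := hr
      rw [homComponent_smul (hf i)]
      exact h i x hx
    | zero => simp
    | add r s _ _ hr hs => rw [add_smul, map_add]; exact add_mem (hr x hx) (hs x hx)
    | smul a r _ hr =>
      rw [smul_eq_mul, mul_comm, mul_smul]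
      exact hr _ (N.smul_mem a hx)
  | add x _ y _ hx hy => rw [map_add]; exact add_mem hx hy

lemma IsHomogeneous.span_smul {ι : Type*} {f : ι → BiPoly K m n} {d : ι → ℤ × ℤ}
    (hf : ∀ i, f i ∈ bigrading K m n (d i)) {N : Submodule (BiPoly K m n) M}
    (hN : N.IsHomogeneous 𝓜) : (Ideal.span (Set.range f) • N).IsHomogeneous 𝓜 :=
  isHomogeneous_iff.2 fun _ _ hx => homComponent_smul_mem hf
    (W := (Ideal.span (Set.range f) • N).toAddSubgroup)
    (fun i x hx => Submodule.smul_mem_smul (Ideal.subset_span ⟨i, rfl⟩)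
      (isHomogeneous_iff.1 hN _ x hx)) hx

variable (𝓜) in
/-- The submodule of elements all of whose components have `φ`-degree at least `b`. -/
def degreeGE (φ : ℤ × ℤ →+ ℤ) (hφ : ∀ v, 0 ≤ φ (biWeight m n v)) (b : ℤ) :
    Submodule (BiPoly K m n) M where
  carrier := {x | ∀ e, φ e < b → homComponent 𝓜 e x = 0}
  zero_mem' := by simp
  add_mem' hx hy e he := by rw [map_add, hx e he, hy e he, add_zero]
  smul_mem' r x hx := by
    induction r using MvPolynomial.induction_on generalizing x with
    | C c =>
      intro e he
      rw [homComponent_smul (C_mem_bigrading c), sub_zero, hx e he, smul_zero]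
    | add p q hp hq =>
      intro e he
      rw [add_smul, map_add, hp _ hx e he, hq _ hx e he, add_zero]
    | mul_X p v hp =>
      rw [mul_smul]
      refine hp _ fun e he => ?_
      rw [homComponent_smul (X_mem_bigrading v), hx _ (by
        have := hφ v
        rw [map_sub]; omega), smul_zero]

lemma mem_degreeGE {φ : ℤ × ℤ →+ ℤ} {hφ : ∀ v, 0 ≤ φ (biWeight m n v)} {b : ℤ} {x : M} :
    x ∈ degreeGE (K := K) 𝓜 φ hφ b ↔ ∀ e, φ e < b → homComponent 𝓜 e x = 0 := Iff.rfl

/-- Finitely many generators have finitely many nonzero components, and multiplication by a variable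
never lowers the `φ`-degree. -/
lemma exists_degreeGE_eq_top [Module.Finite (BiPoly K m n) M] (φ : ℤ × ℤ →+ ℤ)
    (hφ : ∀ v, 0 ≤ φ (biWeight m n v)) : ∃ b, degreeGE (K := K) 𝓜 φ hφ b = ⊤ := by
  obtain ⟨S, hS⟩ := Module.Finite.fg_top (R := BiPoly K m n) (M := M)
  have hfin : (⋃ x ∈ (S : Set M), φ '' {e | homComponent 𝓜 e x ≠ 0}).Finite :=
    S.finite_toSet.biUnion fun x _ => (finite_homComponent_ne_zero x).image _
  obtain ⟨b, hb⟩ := hfin.bddBelow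
  refine ⟨b, eq_top_iff.2 ?_⟩
  rw [← hS, Submodule.span_le]
  intro x hx e he
  by_contra hne
  have := hb (Set.mem_biUnion hx ⟨e, hne, rfl⟩)
  omega

lemma exists_homComponent_eq_zero_of_lt [Module.Finite (BiPoly K m n) M] (φ : ℤ × ℤ →+ ℤ)
    (hφ : ∀ v, 0 ≤ φ (biWeight m n v)) : ∃ b, ∀ (x : M) e, φ e < b → homComponent 𝓜 e x = 0 := by
  obtain ⟨b, hb⟩ := exists_degreeGE_eq_top (K := K) (m := m) (n := n) (𝓜 := 𝓜) φ hφ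
  exact ⟨b, fun x => mem_degreeGE.1 (hb.ge (Submodule.mem_top (x := x)))⟩

lemma fst_biWeight_nonneg (v : Fin m ⊕ Fin n) : 0 ≤ (AddMonoidHom.fst ℤ ℤ) (biWeight m n v) := by
  rcases v with v | v <;> simp [biWeight]

lemma snd_biWeight_nonneg (v : Fin m ⊕ Fin n) : 0 ≤ (AddMonoidHom.snd ℤ ℤ) (biWeight m n v) := by
  rcases v with v | v <;> simp [biWeight]

lemma idealQ_smul_degreeGE_le (b : ℤ) :
    idealQ K m n • degreeGE (K := K) 𝓜 (AddMonoidHom.snd ℤ ℤ)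
        (snd_biWeight_nonneg (m := m) (n := n)) b ≤
      degreeGE (K := K) 𝓜 (AddMonoidHom.snd ℤ ℤ) (snd_biWeight_nonneg (m := m) (n := n))
        (b + 1) := by
  intro x hx e he
  have := homComponent_smul_mem (𝓜 := 𝓜) (f := fun j : Fin n => (MvPolynomial.X (Sum.inr j) : BiPoly K m n))
    (d := fun _ => (0, 1)) (fun j => X_mem_bigrading (Sum.inr j)) (e := e) (W := ⊥) (fun j y hy => by
      rw [AddSubgroup.mem_bot, hy, smul_zero]
      simp only [AddMonoidHom.coe_snd, Prod.snd_sub] at he ⊢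
      omega) hx
  exact this

/-- Graded Nakayama lemma. -/
lemma mem_of_smul_mem_of_sub_one_mem {F N : Submodule (BiPoly K m n) M} (hF : F.IsHomogeneous 𝓜)
    (hN : N.IsHomogeneous 𝓜) {s : BiPoly K m n} (hs : s - 1 ∈ idealQ K m n)
    (h : ∀ x ∈ N, s • x ∈ F) : N ≤ F := by
  intro x hx
  refine mem_of_forall_homComponent_mem (𝓜 := 𝓜) F.toAddSubgroup fun e => ?_
  set y := homComponent 𝓜 e x with hy
  have hye : y ∈ 𝓜 e := homComponent_mem e x
  have h1 : s • y ∈ F := h y (isHomogeneous_iff.1 hN e x hx)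
  have h2 : y ∈ degreeGE (K := K) 𝓜 (AddMonoidHom.snd ℤ ℤ)
      (snd_biWeight_nonneg (m := m) (n := n)) e.2 := by
    intro e' he'
    refine homComponent_of_mem_ne hye ?_
    rintro rfl
    exact lt_irrefl _ he'
  -- Since `s - 1 ∈ Q` strictly raises the `y`-degree, the component of `s • y` in the degree of `y`
  -- is `y` itself.
  have h3 : homComponent 𝓜 e ((s - 1) • y) = 0 :=
    idealQ_smul_degreeGE_le _ (Submodule.smul_mem_smul hs h2) e (by simp)
  have h4 : homComponent 𝓜 e (s • y) = y := by
    rw [sub_smul, one_smul, map_sub, homComponent_of_mem hye, sub_eq_zero] at h3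
    exact h3
  have := isHomogeneous_iff.1 hF e _ h1
  rwa [h4] at this

end Graded

end BigradedCM

/-! ### Functionals over a domain, and reduction modulo `(x_1, …, x_m)` -/

namespace BigradedCM

section Functional

/-- A finitely generated faithful module over a domain has a nonzero linear functional. -/
lemma exists_linearMap_ne_zero {B L : Type*} [CommRing B] [IsDomain B] [AddCommGroup L] [Module B L]
    [Module.Finite B L] (h : ∀ b : B, (∀ l : L, b • l = 0) → b = 0) : ∃ f : L →ₗ[B] B, f ≠ 0 := by
  classical
  -- Otherwise each generator is killed by a nonzero scalar, and the product of these kills `L`.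
  -- Such an `x` survives over the fraction field, where a functional detects it; denominators are
  -- then cleared on generators.
  obtain ⟨x, hx⟩ : ∃ x : L, ∀ b : B, b • x = 0 → b = 0 := by
    by_contra! hcon
    obtain ⟨S, hS⟩ := Module.Finite.fg_top (R := B) (M := L)
    choose b hb hb0 using hcon
    refine Finset.prod_ne_zero_iff.2 (fun x (_ : x ∈ S) => hb0 x) (h _ fun l => ?_)
    have hl : l ∈ Submodule.span B (S : Set L) := hS ▸ Submodule.mem_top
    induction hl using Submodule.span_induction with
    | mem x hx =>
      rw [← Finset.prod_erase_mul _ _ hx, mul_smul, hb, smul_zero]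
    | zero => simp
    | add x y _ _ hx hy => rw [smul_add, hx, hy, add_zero]
    | smul a x _ hx => rw [smul_comm, hx, smul_zero]
  let F := FractionRing B
  let ι := LocalizedModule.mkLinearMap (nonZeroDivisors B) L
  have hx0 : ι x ≠ 0 := by
    intro h0
    obtain ⟨c, hc⟩ := (IsLocalizedModule.eq_zero_iff (nonZeroDivisors B) ι).1 h0
    exact nonZeroDivisors.coe_ne_zero c (hx c hc)
  obtain ⟨g, hg⟩ : ∃ g : Module.Dual F (LocalizedModule (nonZeroDivisors B) L), g (ι x) ≠ 0 := by
    by_contra! hcon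
    exact hx0 ((Module.forall_dual_apply_eq_zero_iff F _).1 hcon)
  let h' : L →ₗ[B] F := (g.restrictScalars B).comp ι
  obtain ⟨S, hS⟩ := Module.Finite.fg_top (R := B) (M := L)
  obtain ⟨b, hb⟩ := IsLocalization.exist_integer_multiples (nonZeroDivisors B) S h'
  have hinj : Function.Injective (Algebra.linearMap B F) := IsFractionRing.injective B F
  have hr : ∀ l, ((b : B) • h') l ∈ LinearMap.range (Algebra.linearMap B F) := by
    suffices (⊤ : Submodule B L) ≤
        (LinearMap.range (Algebra.linearMap B F)).comap ((b : B) • h') from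
      fun l => this Submodule.mem_top
    rw [← hS, Submodule.span_le]
    exact fun l hl => hb l hl
  refine ⟨(LinearEquiv.ofInjective _ hinj).symm.toLinearMap.comp
    (((b : B) • h').codRestrict _ hr), fun h0 => ?_⟩
  have h1 := congrArg (LinearEquiv.ofInjective _ hinj) (LinearMap.congr_fun h0 x)
  simp only [LinearMap.comp_apply, LinearEquiv.coe_coe, LinearEquiv.apply_symm_apply,
    LinearMap.zero_apply, map_zero] at h1
  have h2 : (b : B) • h' x = 0 := congrArg Subtype.val h1
  rw [Algebra.smul_def, mul_eq_zero] at h2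
  refine h2.elim (fun h3 => nonZeroDivisors.coe_ne_zero b ?_) hg
  simp at h3

/-- The ideal is monomial, so each monomial `u` of `p`, shifted by `k` in every variable, has some
exponent at least `k + s`. Then `u` has an exponent at least `s`, beyond the degree of `p`. -/
lemma eq_zero_of_prod_pow_mul_mem {K : Type*} [Field K] {d : ℕ} {p : MvPolynomial (Fin d) K}
    {k s : ℕ} (hs : p.totalDegree < s)
    (h : (∏ i, MvPolynomial.X i) ^ k * p ∈
      Ideal.span (Set.range fun i : Fin d => (MvPolynomial.X i : MvPolynomial (Fin d) K) ^ (k + s))) :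
    p = 0 := by
  classical
  have hr : (Set.range fun i : Fin d => (MvPolynomial.X i : MvPolynomial (Fin d) K) ^ (k + s)) =
      (fun s => MvPolynomial.monomial s (1 : K)) ''
        (Set.range fun i : Fin d => Finsupp.single i (k + s)) := by
    rw [← Set.range_comp]
    congr 1
    funext i
    simp [MvPolynomial.X_pow_eq_monomial]
  have hm : (∏ i, (MvPolynomial.X i : MvPolynomial (Fin d) K)) ^ k =
      MvPolynomial.monomial (Finsupp.equivFunOnFinite.symm fun _ => k) 1 := by
    rw [MvPolynomial.monomial_eq, ← Finset.prod_pow]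
    simp [Finsupp.prod_fintype]
  rw [hr, hm, MvPolynomial.mem_ideal_span_monomial_image] at h
  by_contra hp
  obtain ⟨u, hu⟩ := MvPolynomial.support_nonempty.2 hp
  have hu' : (Finsupp.equivFunOnFinite.symm fun _ => k) + u ∈
      (MvPolynomial.monomial (Finsupp.equivFunOnFinite.symm fun _ => k) (1 : K) * p).support := by
    rw [MvPolynomial.mem_support_iff, MvPolynomial.coeff_monomial_mul, one_mul]
    exact MvPolynomial.mem_support_iff.1 hu
  obtain ⟨_, ⟨i, rfl⟩, hi⟩ := h _ hu'
  have h1 := hi i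
  simp only [Finsupp.single_eq_same, Finsupp.add_apply, Finsupp.equivFunOnFinite_symm_apply_apply]
    at h1
  have h2 : u i ≤ p.totalDegree :=
    (Finsupp.le_degree i u).trans (MvPolynomial.le_totalDegree hu)
  omega

end Functional

/-- The support of `M/IM` is the zero locus of `ann M + I`, and `J ^ k` annihilates this quotient,
so `J` lies in every prime of the support. -/
lemma le_radical_of_pow_smul_le {R M : Type*} [CommRing R] [AddCommGroup M] [Module R M]
    [Module.Finite R M] {J I : Ideal R} {k : ℕ}
    (h : J ^ k • (⊤ : Submodule R M) ≤ I • ⊤) : J ≤ (Module.annihilator R M ⊔ I).radical := by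
  rw [Ideal.radical_eq_sInf]
  refine le_sInf ?_
  rintro p ⟨hp, hpp⟩
  have h1 : (⟨p, hpp⟩ : PrimeSpectrum R) ∈ Module.support R (M ⧸ (I • ⊤ : Submodule R M)) := by
    rw [Module.support_quotient]
    refine ⟨?_, (PrimeSpectrum.mem_zeroLocus _ _).2 ((le_sup_right (b := I)).trans hp)⟩
    rw [Module.mem_support_iff_of_finite]
    exact le_sup_left.trans hp
  rw [Module.mem_support_iff_of_finite] at h1
  refine hpp.le_of_pow_le (n := k) (le_trans (fun r hr => ?_) h1)
  rw [Module.mem_annihilator]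
  intro x
  obtain ⟨x, rfl⟩ := Submodule.Quotient.mk_surjective _ x
  rw [← Submodule.Quotient.mk_smul, Submodule.Quotient.mk_eq_zero]
  exact h (Submodule.smul_mem_smul hr trivial)

lemma span_range_smul_le {ι R M : Type*} [CommRing R] [AddCommGroup M] [Module R M] {f : ι → R}
    {N : Submodule R M} {W : AddSubgroup M} (h : ∀ i, ∀ x ∈ N, f i • x ∈ W) {x : M}
    (hx : x ∈ Ideal.span (Set.range f) • N) : x ∈ W := by
  induction hx using Submodule.smul_induction_on' with
  | smul r hr x hx =>
    induction hr using Submodule.span_induction generalizing x with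
    | mem r hr =>
      obtain ⟨i, rfl⟩ := hr
      exact h i x hx
    | zero => simp
    | add r s _ _ hr hs => rw [add_smul]; exact add_mem (hr x hx) (hs x hx)
    | smul a r _ hr =>
      rw [smul_eq_mul, mul_comm, mul_smul]
      exact hr _ (N.smul_mem a hx)
  | add x _ y _ hx hy => exact add_mem hx hy

section Graded

variable {K : Type u} [Field K] {m n : ℕ} {M : Type u} [AddCommGroup M]
  [Module (BiPoly K m n) M] {𝓜 : ℤ × ℤ → AddSubgroup M} [DirectSum.Decomposition 𝓜]
  [SetLike.GradedSMul (bigrading K m n) 𝓜]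

variable (K m n) in
/-- The ideal `(x_1, …, x_m)`. -/
noncomputable def idealP : Ideal (BiPoly K m n) :=
  Ideal.span (Set.range fun i : Fin m => MvPolynomial.X (Sum.inl i))

lemma IsHomogeneous.idealP_smul {N : Submodule (BiPoly K m n) M} (hN : N.IsHomogeneous 𝓜) :
    (idealP K m n • N).IsHomogeneous 𝓜 :=
  IsHomogeneous.span_smul (d := fun _ => (1, 0)) (fun i => X_mem_bigrading (Sum.inl i)) hN

/-- Graded Nakayama lemma for `(x_1, …, x_m)`, in a fixed `y`-degree. -/
lemma homComponent_mem_of_mem_sup_idealP_smul [Module.Finite (BiPoly K m n) M]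
    {N W : Submodule (BiPoly K m n) M} (hW : W.IsHomogeneous 𝓜) {b : ℤ}
    (h : ∀ x ∈ N, ∀ e : ℤ × ℤ, e.2 = b → homComponent 𝓜 e x ∈ W ⊔ idealP K m n • N) :
    ∀ x ∈ N, ∀ e : ℤ × ℤ, e.2 = b → homComponent 𝓜 e x ∈ W := by
  obtain ⟨b₁, hb₁⟩ := exists_homComponent_eq_zero_of_lt (K := K) (m := m) (n := n) (𝓜 := 𝓜)
    (AddMonoidHom.fst ℤ ℤ) fst_biWeight_nonneg
  -- Induction on the `x`-degree above its lower bound `b₁`: a component of an element of `(x)N`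
  -- involves only components of smaller `x`-degree and the same `y`-degree.
  suffices H : ∀ k : ℕ, ∀ x ∈ N, ∀ e : ℤ × ℤ, e.2 = b → e.1 < b₁ + k → homComponent 𝓜 e x ∈ W from
    fun x hx e he => H (e.1 - b₁ + 1).toNat x hx e he (by omega)
  intro k
  induction k with
  | zero =>
    intro x _ e _ h1
    rw [hb₁ x e (by simpa using h1)]
    exact zero_mem _
  | succ k ih =>
    intro x hx e he h1
    obtain ⟨w, hw, p, hp, hwp⟩ := Submodule.mem_sup.1 (h x hx e he)
    rw [← homComponent_of_mem (homComponent_mem (𝓜 := 𝓜) e x), ← hwp, map_add]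
    refine add_mem (isHomogeneous_iff.1 hW e w hw) ?_
    refine homComponent_smul_mem (W := W.toAddSubgroup) (d := fun _ => (1, 0))
      (fun i => X_mem_bigrading (Sum.inl i)) (fun i y hy => W.smul_mem _ ?_) hp
    refine ih y hy _ (by simpa using he) ?_
    simp only [Prod.fst_sub]
    push_cast at h1
    omega

lemma eq_bot_of_le_idealP_smul [Module.Finite (BiPoly K m n) M]
    {N : Submodule (BiPoly K m n) M} (hN : N.IsHomogeneous 𝓜) (h : N ≤ idealP K m n • N) :
    N = ⊥ := by
  refine eq_bot_iff.2 fun x hx => mem_of_forall_homComponent_mem (𝓜 := 𝓜)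
    (⊥ : Submodule (BiPoly K m n) M).toAddSubgroup fun e => ?_
  refine homComponent_mem_of_mem_sup_idealP_smul IsHomogeneous.bot (b := e.2) ?_ x hx e rfl
  intro y hy e' _
  exact Submodule.mem_sup_right (h (isHomogeneous_iff.1 hN _ _ hy))

/-- Components of large `y`-degree lie in a high power of `Q`. -/
lemma exists_homComponent_mem_idealQ_pow_smul [Module.Finite (BiPoly K m n) M]
    {N : Submodule (BiPoly K m n) M} (hN : N.IsHomogeneous 𝓜) :
    ∃ b : ℤ, ∀ x ∈ N, ∀ (k : ℕ) (e : ℤ × ℤ), b + k ≤ e.2 →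
      homComponent 𝓜 e x ∈ idealQ K m n ^ k • N := by
  obtain ⟨S, hS⟩ := IsNoetherian.noetherian N
  have hfin : (⋃ x ∈ (S : Set M), Prod.snd '' {e | homComponent 𝓜 e x ≠ 0}).Finite :=
    S.finite_toSet.biUnion fun x _ => (finite_homComponent_ne_zero x).image _
  obtain ⟨b, hb⟩ := hfin.bddAbove
  have hSN : ∀ x ∈ S, x ∈ N := fun x hx => hS ▸ Submodule.subset_span hx
  -- `b` bounds the `y`-degrees of the generators, so reaching `y`-degree `b + k` takes at least `k`
  -- factors `y_j`. The multiplier `p` is quantified so that its variables can be peeled off one at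
  -- a time.
  suffices H : ∀ x ∈ Submodule.span (BiPoly K m n) (S : Set M), ∀ (p : BiPoly K m n) (k : ℕ)
      (e : ℤ × ℤ), b + k ≤ e.2 → homComponent 𝓜 e (p • x) ∈ idealQ K m n ^ k • N by
    refine ⟨b, fun x hx k e he => ?_⟩
    have := H x (hS ▸ hx) 1 k e he
    rwa [one_smul] at this
  intro x hx
  induction hx using Submodule.span_induction with
  | zero => simp
  | add x y _ _ hx hy =>
    intro p k e he
    rw [smul_add, map_add]
    exact add_mem (hx p k e he) (hy p k e he)
  | smul a x _ hx =>
    intro p k e he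
    rw [← mul_smul]
    exact hx _ k e he
  | mem x hx =>
    intro p
    induction p using MvPolynomial.induction_on with
    | C c =>
      intro k e he
      rcases k with _ | k
      · rw [pow_zero, Ideal.one_eq_top, Submodule.top_smul]
        exact isHomogeneous_iff.1 hN e _ (N.smul_mem _ (hSN x hx))
      · rw [homComponent_smul (C_mem_bigrading c), sub_zero]
        have : homComponent 𝓜 e x = 0 := by
          by_contra hne
          have := hb (Set.mem_biUnion hx ⟨e, hne, rfl⟩)
          push_cast at he
          omega
        rw [this, smul_zero]
        exact zero_mem _
    | add p q hp hq =>
      intro k e he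
      rw [add_smul, map_add]
      exact add_mem (hp k e he) (hq k e he)
    | mul_X p v hp =>
      intro k e he
      rw [mul_comm, mul_smul, homComponent_smul (X_mem_bigrading v)]
      rcases v with v | v
      · refine Submodule.smul_mem _ _ (hp k _ ?_)
        simpa [biWeight] using he
      · rcases k with _ | k
        · rw [pow_zero, Ideal.one_eq_top, Submodule.top_smul]
          exact N.smul_mem _ (isHomogeneous_iff.1 hN _ _ (N.smul_mem _ (hSN x hx)))
        · rw [pow_succ', Submodule.mul_smul]
          refine Submodule.smul_mem_smul (Ideal.subset_span ⟨v, rfl⟩) (hp k _ ?_)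
          simp only [biWeight, Sum.elim_inr, Prod.snd_sub]
          push_cast at he
          omega

/-- Lifts a containment from `N/(x)N` to `N`, at the price of a larger power of `Q`. That power
pushes all components into `y`-degrees where every component of `N` lies in `Q^k N`, and there
Nakayama for `(x)` works degree by degree. -/
lemma exists_idealQ_pow_smul_le [Module.Finite (BiPoly K m n) M]
    {N W : Submodule (BiPoly K m n) M} (hN : N.IsHomogeneous 𝓜) (hW : W.IsHomogeneous 𝓜) {k : ℕ}
    (h : idealQ K m n ^ k • N ≤ W ⊔ idealP K m n • N) : ∃ k', idealQ K m n ^ k' • N ≤ W := by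
  obtain ⟨b₁, hb₁⟩ := exists_homComponent_mem_idealQ_pow_smul hN
  obtain ⟨b₀, hb₀⟩ := exists_degreeGE_eq_top (K := K) (m := m) (n := n) (𝓜 := 𝓜)
    (AddMonoidHom.snd ℤ ℤ) snd_biWeight_nonneg
  have hpow : ∀ j : ℕ, idealQ K m n ^ j • N ≤ degreeGE (K := K) 𝓜 (AddMonoidHom.snd ℤ ℤ)
      (snd_biWeight_nonneg (m := m) (n := n)) (b₀ + j) := by
    intro j
    induction j with
    | zero => simp [hb₀]
    | succ j ih =>
      rw [pow_succ', Submodule.mul_smul]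
      refine (smul_mono_right _ ih).trans ((idealQ_smul_degreeGE_le _).trans (le_of_eq ?_))
      push_cast
      rw [add_assoc]
  refine ⟨(b₁ + k - b₀).toNat, fun x hx => ?_⟩
  have hxN : x ∈ N := Submodule.smul_le_right hx
  refine mem_of_forall_homComponent_mem (𝓜 := 𝓜) W.toAddSubgroup fun e => ?_
  by_cases he : e.2 < b₀ + (b₁ + k - b₀).toNat
  · rw [hpow _ hx e he]
    exact zero_mem _
  · refine homComponent_mem_of_mem_sup_idealP_smul hW (b := e.2) ?_ x hxN e rfl
    intro y hy e' he'
    exact h (hb₁ y hy k e' (by omega))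

end Graded

end BigradedCM

/-! ### Minimal parameter systems and their algebraic independence -/

namespace BigradedCM

lemma aeval_smul_of_isHomogeneous {K A σ : Type*} [Fintype σ] [CommRing K] [CommRing A] [Algebra K A]
    {F : MvPolynomial σ K} {e : ℕ} (hF : F.IsHomogeneous e) (c : σ → K) (t : A) :
    MvPolynomial.aeval (fun i => c i • t) F = MvPolynomial.eval c F • t ^ e := by
  rw [MvPolynomial.aeval_def, MvPolynomial.eval₂_eq', MvPolynomial.eval_eq', Finset.sum_smul]
  refine Finset.sum_congr rfl fun u hu => ?_
  have hu' : ∑ i, u i = e := by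
    rw [hF.degree_eq_sum_deg_support hu, Finset.sum_subset u.support.subset_univ]
    simp
  rw [Algebra.algebraMap_eq_smul_one, smul_mul_assoc, one_mul, mul_smul]
  congr 1
  simp_rw [smul_pow]
  rw [Finset.prod_smul, Finset.prod_pow_eq_pow_sum, hu']

section Graded

variable {K : Type u} [Field K] {m n : ℕ} {M : Type u} [AddCommGroup M]
  [Module (BiPoly K m n) M] {𝓜 : ℤ × ℤ → AddSubgroup M} [DirectSum.Decomposition 𝓜]
  [SetLike.GradedSMul (bigrading K m n) 𝓜]

lemma aeval_mem_bigrading {d e : ℕ} {z : Fin d → BiPoly K m n}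
    (hz : ∀ i, z i ∈ bigrading K m n (0, 1)) {F : MvPolynomial (Fin d) K} (hF : F.IsHomogeneous e) :
    MvPolynomial.aeval z F ∈ bigrading K m n (0, (e : ℤ)) := by
  rw [MvPolynomial.aeval_def, MvPolynomial.eval₂_eq']
  refine Submodule.sum_mem _ fun u hu => ?_
  have hu' : ∑ i, u i = e := by
    rw [hF.degree_eq_sum_deg_support hu, Finset.sum_subset u.support.subset_univ]
    simp
  rw [Algebra.algebraMap_eq_smul_one, smul_mul_assoc, one_mul]
  refine Submodule.smul_mem _ _ ?_
  have := MvPolynomial.IsWeightedHomogeneous.prod (w := biWeight m n) Finset.univ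
    (fun i => z i ^ u i) (fun i => u i • ((0, 1) : ℤ × ℤ)) (fun i _ => (hz i).pow (u i))
  rw [← Finset.sum_smul, hu'] at this
  simpa using this

/-- Linear forms `z` of degree `(0, 1)` such that `Q` is, up to radical, generated by `z` on
`N / (x_1, …, x_m) N`. -/
def IsParameterSystem (N : Submodule (BiPoly K m n) M) {d : ℕ} (z : Fin d → BiPoly K m n) : Prop :=
  (∀ i, z i ∈ idealQ K m n) ∧ (∀ i, z i ∈ bigrading K m n (0, 1)) ∧
    ∃ k, idealQ K m n ^ k • N ≤ Ideal.span (Set.range z) • N ⊔ idealP K m n • N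

lemma exists_isParameterSystem_minimal (N : Submodule (BiPoly K m n) M) :
    ∃ (d : ℕ) (z : Fin d → BiPoly K m n), IsParameterSystem N z ∧
      ∀ d' < d, ∀ z' : Fin d' → BiPoly K m n, ¬ IsParameterSystem N z' := by
  classical
  have h : ∃ d : ℕ, ∃ z : Fin d → BiPoly K m n, IsParameterSystem N z := by
    refine ⟨n, fun j => MvPolynomial.X (Sum.inr j), fun j => Ideal.subset_span ⟨j, rfl⟩,
      fun j => X_mem_bigrading (Sum.inr j), 1, ?_⟩
    rw [pow_one]
    exact le_sup_left
  obtain ⟨z, hz⟩ := Nat.find_spec h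
  exact ⟨Nat.find h, z, hz, fun d' hd' z' hz' => Nat.find_min h hd' ⟨z', hz'⟩⟩

/-- On a homogeneous element, the homogeneous parts of `F`, evaluated at forms of degree `(0, 1)`,
act into different bidegrees, so a relation splits into its homogeneous parts. -/
lemma aeval_homogeneousComponent_smul_mem {N W : Submodule (BiPoly K m n) M}
    (hN : N.IsHomogeneous 𝓜) (hW : W.IsHomogeneous 𝓜) {d : ℕ} {z : Fin d → BiPoly K m n}
    (hz : ∀ i, z i ∈ bigrading K m n (0, 1)) {F : MvPolynomial (Fin d) K}
    (hF : ∀ x ∈ N, MvPolynomial.aeval z F • x ∈ W) (e : ℕ) :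
    ∀ x ∈ N, MvPolynomial.aeval z (MvPolynomial.homogeneousComponent e F) • x ∈ W := by
  intro x hx
  refine mem_of_forall_homComponent_mem (𝓜 := 𝓜) W.toAddSubgroup fun t => ?_
  have hmem : ∀ i : ℕ, MvPolynomial.aeval z (MvPolynomial.homogeneousComponent i F) ∈
      bigrading K m n (0, (i : ℤ)) := fun i =>
    aeval_mem_bigrading hz (MvPolynomial.homogeneousComponent_isHomogeneous i F)
  rw [homComponent_smul (hmem e)]
  set y := homComponent 𝓜 (t - (0, (e : ℤ))) x with hy
  have hyN : y ∈ N := isHomogeneous_iff.1 hN _ x hx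
  have hyt : y ∈ 𝓜 (t - (0, (e : ℤ))) := homComponent_mem _ _
  have key : homComponent 𝓜 t (MvPolynomial.aeval z F • y) =
      MvPolynomial.aeval z (MvPolynomial.homogeneousComponent e F) • y := by
    conv_lhs => rw [← MvPolynomial.sum_homogeneousComponent F]
    rw [map_sum, Finset.sum_smul, map_sum, Finset.sum_eq_single e]
    · rw [homComponent_smul (hmem e), homComponent_of_mem hyt]
    · intro i _ hi
      rw [homComponent_smul (hmem i), homComponent_of_mem_ne hyt, smul_zero]
      intro h
      have := congrArg Prod.snd (sub_right_injective h)
      simp only [Nat.cast_inj] at this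
      exact hi this.symm
    · intro he
      rw [MvPolynomial.homogeneousComponent_eq_zero _ _ (by simpa using he), map_zero, zero_smul,
        map_zero]
  exact key ▸ isHomogeneous_iff.1 hW t _ (hF y hyN)

lemma C_mul_mem_bigrading {a : K} {t : ℤ × ℤ} {r : BiPoly K m n} (hr : r ∈ bigrading K m n t) :
    MvPolynomial.C a * r ∈ bigrading K m n t := by
  rw [MvPolynomial.C_mul']
  exact Submodule.smul_mem _ _ hr

/-- Replace `z_i` by `z_i - (c_i/c_l) z_l` for `i ≠ l`. Modulo these forms `z` is proportional to
`c`, so `F(z)` becomes a nonzero scalar times `z_l ^ e`. The relation thus makes `z_l` nilpotent on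
the quotient, and `z_l` can be dropped. -/
lemma IsParameterSystem.exists_of_aeval_smul_mem {N : Submodule (BiPoly K m n) M} {d e : ℕ}
    {z : Fin (d + 1) → BiPoly K m n} (hz : IsParameterSystem N z)
    {F : MvPolynomial (Fin (d + 1)) K} (hF : F.IsHomogeneous e) {c : Fin (d + 1) → K}
    (hc : MvPolynomial.eval c F ≠ 0) {l : Fin (d + 1)} (hl : c l ≠ 0)
    (h : ∀ x ∈ N, MvPolynomial.aeval z F • x ∈ idealP K m n • N) :
    ∃ z' : Fin d → BiPoly K m n, IsParameterSystem N z' := by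
  obtain ⟨hzQ, hzh, k, hk⟩ := hz
  let z' : Fin d → BiPoly K m n := fun i =>
    z (l.succAbove i) - MvPolynomial.C (c (l.succAbove i) * (c l)⁻¹) * z l
  let Z := Ideal.span (Set.range z')
  have hzl : ∀ j, Ideal.Quotient.mk Z (z j) = c j • ((c l)⁻¹ • Ideal.Quotient.mk Z (z l)) := by
    intro j
    rw [smul_smul]
    rcases l.eq_self_or_eq_succAbove j with rfl | ⟨i, rfl⟩
    · rw [mul_inv_cancel₀ hl, one_smul]
    · have h1 : Ideal.Quotient.mk Z (z' i) = 0 :=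
        Ideal.Quotient.eq_zero_iff_mem.2 (Ideal.subset_span ⟨i, rfl⟩)
      rw [map_sub, sub_eq_zero, MvPolynomial.C_mul'] at h1
      rw [h1]
      rfl
  have hpow : ∃ a : K, z l ^ e - MvPolynomial.C a * MvPolynomial.aeval z F ∈ Z := by
    refine ⟨c l ^ e * (MvPolynomial.eval c F)⁻¹, ?_⟩
    rw [← Ideal.Quotient.eq_zero_iff_mem, map_sub, sub_eq_zero, MvPolynomial.C_mul']
    have h1 : Ideal.Quotient.mk Z (MvPolynomial.aeval z F) =
        MvPolynomial.eval c F • ((c l)⁻¹ • Ideal.Quotient.mk Z (z l)) ^ e := by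
      rw [← aeval_smul_of_isHomogeneous hF, ← funext hzl]
      exact DFunLike.congr_fun (MvPolynomial.comp_aeval z (Ideal.Quotient.mkₐ K Z)) F
    have h2 : Ideal.Quotient.mk Z ((c l ^ e * (MvPolynomial.eval c F)⁻¹) •
        MvPolynomial.aeval z F) = (c l ^ e * (MvPolynomial.eval c F)⁻¹) •
        Ideal.Quotient.mk Z (MvPolynomial.aeval z F) := rfl
    rw [h2, h1, smul_smul, mul_assoc, inv_mul_cancel₀ hc, mul_one, smul_pow, smul_smul, ← mul_pow,
      mul_inv_cancel₀ hl, one_pow, one_smul, map_pow]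
  obtain ⟨a, ha⟩ := hpow
  have hspan : Ideal.span (Set.range z) ≤ Z ⊔ Ideal.span {z l} := by
    rw [Ideal.span_le]
    rintro _ ⟨j, rfl⟩
    rcases l.eq_self_or_eq_succAbove j with rfl | ⟨i, rfl⟩
    · exact Ideal.mem_sup_right (Ideal.mem_span_singleton_self _)
    · have : z (l.succAbove i) = z' i + MvPolynomial.C (c (l.succAbove i) * (c l)⁻¹) * z l := by
        simp [z']
      rw [this]
      exact Submodule.add_mem_sup (Ideal.subset_span ⟨i, rfl⟩)
        (Ideal.mul_mem_left _ _ (Ideal.mem_span_singleton_self _))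
  have hzlN : Ideal.span {z l} ^ e • N ≤ (Z ⊔ idealP K m n) • N := by
    rw [Ideal.span_singleton_pow, Submodule.smul_le]
    intro r hr x hx
    obtain ⟨b, rfl⟩ := Ideal.mem_span_singleton'.1 hr
    rw [mul_smul]
    refine Submodule.smul_mem _ _ ?_
    rw [← sub_add_cancel (z l ^ e) (MvPolynomial.C a * MvPolynomial.aeval z F), add_smul, mul_smul,
      Submodule.sup_smul]
    exact Submodule.add_mem_sup (Submodule.smul_mem_smul ha hx) (Submodule.smul_mem _ _ (h x hx))
  -- The exponent comes from `(A + B)^(1+e) ⊆ A + B^e`, with `A = (z') + (x)` and `B = (z_l)`.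
  refine ⟨z', fun i => Ideal.sub_mem _ (hzQ _) (Ideal.mul_mem_left _ _ (hzQ _)),
    fun i => Submodule.sub_mem _ (hzh _) (C_mul_mem_bigrading (hzh _)), k * (1 + e), ?_⟩
  have h1 : idealQ K m n ^ k • N ≤ ((Z ⊔ idealP K m n) ⊔ Ideal.span {z l}) • N := by
    refine hk.trans ?_
    rw [← Submodule.sup_smul]
    refine Submodule.smul_mono_left (sup_le (hspan.trans ?_) ?_)
    · exact sup_le (le_sup_left.trans le_sup_left) le_sup_right
    · exact le_sup_right.trans le_sup_left
  have h2 : ∀ j : ℕ, (idealQ K m n ^ k) ^ j • N ≤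
      ((Z ⊔ idealP K m n) ⊔ Ideal.span {z l}) ^ j • N := by
    intro j
    induction j with
    | zero => simp
    | succ j ih =>
      rw [pow_succ, Submodule.mul_smul]
      refine (smul_mono_right _ h1).trans ?_
      rw [← Submodule.mul_smul, mul_comm, Submodule.mul_smul]
      refine (smul_mono_right _ ih).trans ?_
      rw [← Submodule.mul_smul, ← pow_succ']
  rw [pow_mul, ← Submodule.sup_smul]
  refine (h2 _).trans ((Submodule.smul_mono_left Ideal.sup_pow_add_le_pow_sup_pow).trans ?_)
  rw [Submodule.sup_smul, pow_one]
  exact sup_le le_rfl hzlN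

/-- The members of a minimal parameter system are algebraically independent on
`N / (x_1, …, x_m) N`. -/
lemma eq_zero_of_aeval_smul_mem [Infinite K] [Module.Finite (BiPoly K m n) M]
    {N : Submodule (BiPoly K m n) M} (hN : N.IsHomogeneous 𝓜) (hN0 : N ≠ ⊥) {d : ℕ}
    {z : Fin d → BiPoly K m n} (hz : IsParameterSystem N z)
    (hmin : ∀ d' < d, ∀ z' : Fin d' → BiPoly K m n, ¬ IsParameterSystem N z')
    {F : MvPolynomial (Fin d) K} (hF : ∀ x ∈ N, MvPolynomial.aeval z F • x ∈ idealP K m n • N) :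
    F = 0 := by
  by_contra hF0
  obtain ⟨e, he⟩ : ∃ e, MvPolynomial.homogeneousComponent e F ≠ 0 := by
    by_contra! hcon
    exact hF0 (by rw [← MvPolynomial.sum_homogeneousComponent F]; simp [hcon])
  have hFe := aeval_homogeneousComponent_smul_mem hN (IsHomogeneous.idealP_smul hN) hz.2.1 hF e
  have hhom := MvPolynomial.homogeneousComponent_isHomogeneous e F
  generalize MvPolynomial.homogeneousComponent e F = G at he hFe hhom
  -- Over an infinite field a nonzero polynomial has a point where it does not vanish.
  obtain ⟨c, hc⟩ : ∃ c, MvPolynomial.eval c G ≠ 0 := by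
    by_contra! hcon
    exact he (MvPolynomial.funext fun c => by rw [hcon, map_zero])
  by_cases hc0 : ∃ l, c l ≠ 0
  · obtain ⟨l, hl⟩ := hc0
    rcases d with _ | d
    · exact l.elim0
    · obtain ⟨z', hz'⟩ := hz.exists_of_aeval_smul_mem hhom hc hl hFe
      exact hmin d d.lt_succ_self z' hz'
  -- A form not vanishing at the origin is a nonzero constant, so the relation says `N = (x)N`,
  -- against `N ≠ 0`.
  · push Not at hc0
    have hG : G = MvPolynomial.C (G.coeff 0) := by
      have h0 : MvPolynomial.constantCoeff G ≠ 0 := by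
        rw [← MvPolynomial.eval_zero]
        rwa [show c = 0 from funext hc0] at hc
      have he0 : e = 0 := by
        by_contra hne
        exact h0 (hhom.coeff_eq_zero (by simpa using Ne.symm hne))
      subst he0
      exact MvPolynomial.totalDegree_eq_zero_iff_eq_C.1
        ((MvPolynomial.totalDegree_zero_iff_isHomogeneous _).2 hhom)
    have ha : G.coeff 0 ≠ 0 := fun h0 => he (by rw [hG, h0, map_zero])
    refine hN0 (eq_bot_of_le_idealP_smul hN fun x hx => ?_)
    have h1 := Submodule.smul_mem _ (MvPolynomial.C (G.coeff 0)⁻¹ : BiPoly K m n) (hFe x hx)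
    rw [hG, MvPolynomial.aeval_C, MvPolynomial.algebraMap_eq, ← mul_smul, ← map_mul,
      MvPolynomial.coeff_C] at h1
    simpa [ha] using h1

end Graded

end BigradedCM

/-! ### Finiteness over the parameters and nonvanishing in the top degree -/

namespace BigradedCM

section ScalarSpan

variable {A S M : Type*} [CommRing A] [CommRing S] [AddCommGroup M] [Module S M]

/-- The span of `G` over `A`, acting through `φ : A →+* S`. -/
def scalarSpan (φ : A →+* S) (G : Set M) : AddSubgroup M :=
  AddSubgroup.closure {x | ∃ a, ∃ g ∈ G, φ a • g = x}

lemma smul_mem_scalarSpan {φ : A →+* S} {G G' : Set M} {r : S}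
    (h : ∀ a, ∀ g ∈ G, r • φ a • g ∈ scalarSpan φ G') {x : M} (hx : x ∈ scalarSpan φ G) :
    r • x ∈ scalarSpan φ G' := by
  induction hx using AddSubgroup.closure_induction with
  | mem x hx => obtain ⟨a, g, hg, rfl⟩ := hx; exact h a g hg
  | zero => rw [smul_zero]; exact zero_mem _
  | add x y _ _ hx hy => rw [smul_add]; exact add_mem hx hy
  | neg x _ hx => rw [smul_neg]; exact neg_mem hx

/-- The image of `N` in `M/W` is a finite faithful `A`-module through `φ`. A nonzero functional on
it is pulled back to `N`. -/
lemma exists_addMonoidHom_ne_zero [IsDomain A] (φ : A →+* S) {N W : Submodule S M} {G : Set M}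
    (hG : G.Finite) (hGN : G ⊆ N) (hN : ∀ x ∈ N, x ∈ scalarSpan φ G ⊔ W.toAddSubgroup)
    (h : ∀ a, (∀ x ∈ N, φ a • x ∈ W) → a = 0) :
    ∃ f : N →+ A, f ≠ 0 ∧ ∀ a x, f (φ a • x) = a * f x := by
  let _ : Module A (M ⧸ W) := Module.compHom _ φ
  have hsm : ∀ (a : A) (x : M), a • W.mkQ x = W.mkQ (φ a • x) := fun a x => (map_smul W.mkQ _ x).symm
  let L : Submodule A (M ⧸ W) := Submodule.span A (W.mkQ '' G)
  have hfin : Module.Finite A L := Module.Finite.span_of_finite A (hG.image _)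
  have hNL : ∀ x ∈ N, W.mkQ x ∈ L := by
    intro x hx
    obtain ⟨y, hy, w, hw, rfl⟩ := AddSubgroup.mem_sup.1 (hN x hx)
    have hw' : W.mkQ w = 0 := (Submodule.Quotient.mk_eq_zero W).2 hw
    rw [map_add, hw', add_zero]
    clear hx
    induction hy using AddSubgroup.closure_induction with
    | mem x hx =>
      obtain ⟨a, g, hg, rfl⟩ := hx
      rw [← hsm]
      exact L.smul_mem a (Submodule.subset_span ⟨g, hg, rfl⟩)
    | zero => rw [map_zero]; exact zero_mem _
    | add x y _ _ hx hy => rw [map_add]; exact add_mem hx hy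
    | neg x _ hx => rw [map_neg]; exact neg_mem hx
  have hLN : ∀ l ∈ L, ∃ x ∈ N, W.mkQ x = l := by
    intro l hl
    induction hl using Submodule.span_induction with
    | mem l hl => obtain ⟨g, hg, rfl⟩ := hl; exact ⟨g, hGN hg, rfl⟩
    | zero => exact ⟨0, N.zero_mem, map_zero _⟩
    | add l l' _ _ hl hl' =>
      obtain ⟨x, hx, rfl⟩ := hl
      obtain ⟨y, hy, rfl⟩ := hl'
      exact ⟨x + y, N.add_mem hx hy, map_add _ _ _⟩
    | smul a l _ hl =>
      obtain ⟨x, hx, rfl⟩ := hl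
      exact ⟨φ a • x, N.smul_mem _ hx, (hsm a x).symm⟩
  obtain ⟨f, hf⟩ := exists_linearMap_ne_zero (B := A) (L := L) fun a ha => h a fun x hx => by
    have h1 := congrArg Subtype.val (ha ⟨W.mkQ x, hNL x hx⟩)
    have h2 : a • W.mkQ x = 0 := h1
    rw [hsm] at h2
    exact (Submodule.Quotient.mk_eq_zero W).1 h2
  refine ⟨AddMonoidHom.mk' (fun x : N => f ⟨W.mkQ x, hNL x x.2⟩) fun x y => ?_, fun h0 => hf ?_,
    fun a x => ?_⟩
  · rw [← map_add]
    congr 1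
  · ext ⟨l, hl⟩
    obtain ⟨x, hx, rfl⟩ := hLN l hl
    exact DFunLike.congr_fun h0 ⟨x, hx⟩
  · change f ⟨W.mkQ (φ a • x), _⟩ = a * f ⟨W.mkQ x, _⟩
    rw [← smul_eq_mul, ← map_smul]
    exact congrArg f (Subtype.ext (hsm a x).symm)

end ScalarSpan

section Graded

variable {K : Type u} [Field K] {m n : ℕ} {M : Type u} [AddCommGroup M]
  [Module (BiPoly K m n) M] {𝓜 : ℤ × ℤ → AddSubgroup M} [DirectSum.Decomposition 𝓜]
  [SetLike.GradedSMul (bigrading K m n) 𝓜]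

lemma homComponent_mem_scalarSpan {G : Set M} (hG : ∀ g ∈ G, ∃ e, g ∈ 𝓜 e) (e : ℤ × ℤ) {x : M}
    (hx : x ∈ scalarSpan (MvPolynomial.C : K →+* BiPoly K m n) G) :
    homComponent 𝓜 e x ∈ scalarSpan (MvPolynomial.C : K →+* BiPoly K m n) G := by
  induction hx using AddSubgroup.closure_induction with
  | mem x hx =>
    obtain ⟨a, g, hg, rfl⟩ := hx
    obtain ⟨e', he'⟩ := hG g hg
    rw [homComponent_smul (C_mem_bigrading a), sub_zero]
    by_cases h : e' = e
    · subst h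
      rw [homComponent_of_mem he']
      exact AddSubgroup.subset_closure ⟨a, g, hg, rfl⟩
    · rw [homComponent_of_mem_ne he' h, smul_zero]
      exact zero_mem _
  | zero => rw [map_zero]; exact zero_mem _
  | add x y _ _ hx hy => rw [map_add]; exact add_mem hx hy
  | neg x _ hx => rw [map_neg]; exact neg_mem hx

lemma mem_of_forall_generator {K : Type*} [Field K] {σ : Type*} {M : Type*} [AddCommGroup M]
    [Module (MvPolynomial σ K) M] {G : Set M} {W : AddSubgroup M}
    (hC : ∀ (c : K), ∀ g ∈ G, (MvPolynomial.C c : MvPolynomial σ K) • g ∈ W)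
    (hX : ∀ (v : σ), ∀ x ∈ Submodule.span (MvPolynomial σ K) G,
      (MvPolynomial.X v : MvPolynomial σ K) • x ∈ W) {x : M}
    (hx : x ∈ Submodule.span (MvPolynomial σ K) G) : x ∈ W := by
  induction hx using Submodule.closure_induction with
  | zero => exact zero_mem _
  | add x y _ _ hx hy => exact add_mem hx hy
  | smul_mem p g hg =>
    induction p using MvPolynomial.induction_on with
    | C c => exact hC c g hg
    | add p q hp hq => rw [add_smul]; exact add_mem hp hq
    | mul_X p v _ =>
      rw [mul_comm, mul_smul]
      exact hX v _ (Submodule.smul_mem _ _ (Submodule.subset_span hg))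

/-- `N/(Q^k N + (x)N)` is finite-dimensional over `K`: passing from `k` to `k + 1` requires only
generators of `N` and the multiples by the `y_j` of the previous spanning set. -/
lemma exists_finite_forall_mem_scalarSpan_sup [Module.Finite (BiPoly K m n) M]
    {N : Submodule (BiPoly K m n) M} (hN : N.IsHomogeneous 𝓜) (k : ℕ) :
    ∃ G : Set M, G.Finite ∧ (∀ g ∈ G, ∃ e, g ∈ 𝓜 e) ∧ G ⊆ N ∧ ∀ x ∈ N,
      x ∈ scalarSpan (MvPolynomial.C : K →+* BiPoly K m n) G ⊔
        (idealQ K m n ^ k • N ⊔ idealP K m n • N).toAddSubgroup := by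
  induction k with
  | zero =>
    refine ⟨∅, Set.finite_empty, by simp, Set.empty_subset _, fun x hx => ?_⟩
    refine AddSubgroup.mem_sup_right (Submodule.mem_sup_left ?_)
    rwa [pow_zero, Ideal.one_eq_top, Submodule.top_smul]
  | succ k ih =>
    obtain ⟨G, hfin, hhom, hGN, hG⟩ := ih
    obtain ⟨G₀, hfin₀, hhom₀, rfl⟩ := exists_finite_homogeneous_span_eq hN
    refine ⟨G₀ ∪ ⋃ v : Fin n, (fun g => (MvPolynomial.X (Sum.inr v) : BiPoly K m n) • g) '' G,
      hfin₀.union (Set.finite_iUnion fun v => hfin.image _), ?_, ?_, fun x hx => ?_⟩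
    · rintro g (hg | hg)
      · exact hhom₀ g hg
      · obtain ⟨v, g, hgG, rfl⟩ := Set.mem_iUnion.1 hg
        obtain ⟨e, he⟩ := hhom g hgG
        exact ⟨_, smul_mem_graded (X_mem_bigrading (Sum.inr v)) he⟩
    · rintro g (hg | hg)
      · exact Submodule.subset_span hg
      · obtain ⟨v, g, hgG, rfl⟩ := Set.mem_iUnion.1 hg
        exact Submodule.smul_mem _ _ (hGN hgG)
    · refine mem_of_forall_generator (fun c g hg => ?_) (fun v y hy => ?_) hx
      · exact AddSubgroup.mem_sup_left (AddSubgroup.subset_closure ⟨c, g, Or.inl hg, rfl⟩)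
      · rcases v with v | v
        · exact AddSubgroup.mem_sup_right (Submodule.mem_sup_right
            (Submodule.smul_mem_smul (Ideal.subset_span ⟨v, rfl⟩) hy))
        · obtain ⟨a, ha, b, hb, rfl⟩ := AddSubgroup.mem_sup.1 (hG y hy)
          obtain ⟨b₁, hb₁, b₂, hb₂, rfl⟩ := Submodule.mem_sup.1 hb
          rw [smul_add]
          refine AddSubgroup.add_mem_sup (smul_mem_scalarSpan (fun c g hg => ?_) ha) ?_
          · rw [smul_comm]
            exact AddSubgroup.subset_closure
              ⟨c, _, Or.inr (Set.mem_iUnion.2 ⟨v, g, hg, rfl⟩), rfl⟩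
          · rw [smul_add]
            refine Submodule.add_mem_sup ?_ (Submodule.smul_mem _ _ hb₂)
            rw [pow_succ', Submodule.mul_smul]
            exact Submodule.smul_mem_smul (Ideal.subset_span ⟨v, rfl⟩) hb₁

/-- Graded Noether normalization. Modulo `(z)N + (x)N` a finite `K`-spanning set suffices, and
coefficients of the `z_i` have smaller `y`-degree, so induction on that degree, bounded below,
expresses everything over `K[z]`. -/
lemma IsParameterSystem.exists_finite_scalarSpan [Module.Finite (BiPoly K m n) M]
    {N : Submodule (BiPoly K m n) M} (hN : N.IsHomogeneous 𝓜) {d : ℕ} {z : Fin d → BiPoly K m n}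
    (hz : IsParameterSystem N z) :
    ∃ G : Set M, G.Finite ∧ G ⊆ N ∧ ∀ x ∈ N,
      x ∈ scalarSpan (MvPolynomial.aeval (R := K) z : MvPolynomial (Fin d) K →+* BiPoly K m n) G ⊔
        (idealP K m n • N).toAddSubgroup := by
  obtain ⟨-, hzh, k, hk⟩ := hz
  obtain ⟨G, hfin, hhom, hGN, hG⟩ := exists_finite_forall_mem_scalarSpan_sup hN k
  refine ⟨G, hfin, hGN, ?_⟩
  set φ : MvPolynomial (Fin d) K →+* BiPoly K m n :=
    (MvPolynomial.aeval (R := K) z : MvPolynomial (Fin d) K →+* BiPoly K m n) with hφ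
  set T := scalarSpan φ G ⊔ (idealP K m n • N).toAddSubgroup with hT
  have hzT : ∀ i, ∀ x ∈ T, z i • x ∈ T := by
    intro i x hx
    obtain ⟨a, ha, b, hb, rfl⟩ := AddSubgroup.mem_sup.1 hx
    rw [smul_add]
    refine AddSubgroup.add_mem_sup (smul_mem_scalarSpan (fun c g hg => ?_) ha)
      ((idealP K m n • N).smul_mem _ hb)
    refine AddSubgroup.subset_closure ⟨MvPolynomial.X i * c, g, hg, ?_⟩
    rw [map_mul, mul_smul]
    congr 1
    exact MvPolynomial.aeval_X z i
  have hKT : scalarSpan (MvPolynomial.C : K →+* BiPoly K m n) G ≤ T := by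
    refine le_trans ?_ le_sup_left
    rw [scalarSpan, AddSubgroup.closure_le]
    rintro _ ⟨c, g, hg, rfl⟩
    refine AddSubgroup.subset_closure ⟨MvPolynomial.C c, g, hg, ?_⟩
    congr 1
    exact MvPolynomial.aeval_C z c
  obtain ⟨b₀, hb₀⟩ := exists_homComponent_eq_zero_of_lt (K := K) (m := m) (n := n) (𝓜 := 𝓜)
    (AddMonoidHom.snd ℤ ℤ) snd_biWeight_nonneg
  suffices H : ∀ k : ℕ, ∀ x ∈ N, ∀ e : ℤ × ℤ, e.2 < b₀ + k → homComponent 𝓜 e x ∈ T from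
    fun x hx => mem_of_forall_homComponent_mem (𝓜 := 𝓜) T fun e =>
      H (e.2 - b₀ + 1).toNat x hx e (by omega)
  intro k
  induction k with
  | zero =>
    intro x _ e h1
    rw [hb₀ x e (by simpa using h1)]
    exact zero_mem _
  | succ k ih =>
    intro x hx e he
    obtain ⟨a, ha, b, hb, rfl⟩ := AddSubgroup.mem_sup.1 (hG x hx)
    obtain ⟨b₁, hb₁, b₂, hb₂, rfl⟩ := Submodule.mem_sup.1 (sup_le hk le_sup_right hb)
    rw [map_add, map_add]
    refine add_mem (hKT (homComponent_mem_scalarSpan hhom e ha)) (add_mem ?_ ?_)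
    · refine homComponent_smul_mem (d := fun _ => (0, 1)) hzh (fun i y hy => hzT i _ (ih y hy _ ?_))
        hb₁
      simp only [Prod.snd_sub]
      push_cast at he
      omega
    · exact AddSubgroup.mem_sup_right (isHomogeneous_iff.1 (IsHomogeneous.idealP_smul hN) e _ hb₂)

/-- A nonzero graded module has a system of parameters with respect to `Q` in the top local
cohomology of which it is nonzero. -/
lemma exists_parameters_not_vanishes [Infinite K] [Module.Finite (BiPoly K m n) M]
    {N : Submodule (BiPoly K m n) M} (hN : N.IsHomogeneous 𝓜) (hN0 : N ≠ ⊥) :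
    ∃ zs : List (BiPoly K m n), (∀ z ∈ zs, z ∈ idealQ K m n) ∧
      idealQ K m n ≤ (Module.annihilator (BiPoly K m n) N ⊔ Ideal.span {z | z ∈ zs}).radical ∧
      ¬ LocalCohomologyVanishes (idealQ K m n) zs.length N := by
  obtain ⟨d, z, hz, hmin⟩ := exists_isParameterSystem_minimal N
  have hset : {w | w ∈ List.ofFn z} = Set.range z := by
    ext w
    simp [List.mem_ofFn]
  have hzs : ∀ w ∈ List.ofFn z, w ∈ idealQ K m n := by
    intro w hw
    obtain ⟨i, rfl⟩ := List.mem_ofFn.1 hw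
    exact hz.1 i
  have hrad : idealQ K m n ≤
      (Module.annihilator (BiPoly K m n) N ⊔ Ideal.span {w | w ∈ List.ofFn z}).radical := by
    rw [hset]
    obtain ⟨k, hk⟩ := hz.2.2
    obtain ⟨k', hk'⟩ := exists_idealQ_pow_smul_le hN
      (IsHomogeneous.span_smul (d := fun _ => (0, 1)) hz.2.1 hN) hk
    refine le_radical_of_pow_smul_le (k := k') (M := N) ?_
    have hmap : ∀ I : Ideal (BiPoly K m n),
        (I • (⊤ : Submodule (BiPoly K m n) N)).map N.subtype = I • N := fun I => by
      rw [Submodule.map_smul'', Submodule.map_subtype_top]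
    rw [← Submodule.map_le_map_iff_of_injective N.injective_subtype, hmap, hmap]
    exact hk'
  refine ⟨List.ofFn z, hzs, hrad, fun hv => ?_⟩
  have htors : IsPowerTorsion (Module.annihilator (BiPoly K m n) N) N := fun x =>
    ⟨1, fun r hr => Module.mem_annihilator.1 (by rwa [pow_one] at hr) x⟩
  have hT := htors.topCechVanishes hzs hrad hv
  obtain ⟨G, hfin, hGN, hG⟩ := hz.exists_finite_scalarSpan hN
  obtain ⟨f, hf0, hf⟩ := exists_addMonoidHom_ne_zero _ hfin hGN hG fun F hF =>
    eq_zero_of_aeval_smul_mem hN hN0 hz hmin hF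
  have hfX : ∀ (F : MvPolynomial (Fin d) K) x, f (MvPolynomial.aeval z F • x) = F * f x := hf
  refine hf0 (AddMonoidHom.ext fun x => ?_)
  -- The Čech relation is taken with a gap exceeding the degree of `f x`. Its image under `f` is
  -- then impossible for a nonzero polynomial.
  obtain ⟨k, hk⟩ := hT x ((f x).totalDegree + 1)
  refine eq_zero_of_prod_pow_mul_mem (k := k) (Nat.lt_succ_self (f x).totalDegree) ?_
  have hprod : (List.ofFn z).prod ^ k =
      MvPolynomial.aeval z ((∏ i, MvPolynomial.X i : MvPolynomial (Fin d) K) ^ k) := by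
    rw [List.prod_ofFn, map_pow, map_prod]
    simp
  rw [hprod, hset, ← Set.range_comp] at hk
  rw [← hfX]
  refine span_range_smul_le (W := (Submodule.toAddSubgroup (Ideal.span (Set.range
    fun i : Fin d => (MvPolynomial.X i : MvPolynomial (Fin d) K) ^
      (k + ((f x).totalDegree + 1))))).comap f) (fun i y _ => ?_) hk
  have h1 : z i ^ (k + ((f x).totalDegree + 1)) = MvPolynomial.aeval z
      ((MvPolynomial.X i : MvPolynomial (Fin d) K) ^ (k + ((f x).totalDegree + 1))) := by
    rw [map_pow, MvPolynomial.aeval_X]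
  change f (z i ^ (k + ((f x).totalDegree + 1)) • y) ∈ Ideal.span (Set.range
    fun i : Fin d => (MvPolynomial.X i : MvPolynomial (Fin d) K) ^
      (k + ((f x).totalDegree + 1)))
  rw [h1, hfX]
  exact Ideal.mul_mem_right _ _ (Ideal.subset_span ⟨i, rfl⟩)

end Graded

end BigradedCM

/-! ### Cohomological dimension and subquotients -/

namespace BigradedCM

section Relative

variable {R : Type u} [CommRing R] {I : Ideal R} {M X : Type u} [AddCommGroup M] [Module R M]
  [AddCommGroup X] [Module R X]

lemma localCohomologyNonzero_iff {i : ℕ} :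
    LocalCohomologyNonzero I X i ↔ ¬ LocalCohomologyVanishes I i X :=
  (isZero_localCohomology_iff_vanishes ..).not

lemma isCohenMacaulay_iff :
    IsCohenMacaulay I X ↔ ∃ q : ℕ, ∀ i, i ≠ q → LocalCohomologyVanishes I i X := by
  simp only [IsCohenMacaulay, localCohomologyNonzero_iff, not_not]

lemma le_cohomDim {i : ℕ} (h : ¬ LocalCohomologyVanishes I i X) :
    ((i : ℕ∞) : WithBot ℕ∞) ≤ cohomDim I X :=
  le_iSup₂_of_le (f := fun (i : ℕ) (_ : LocalCohomologyNonzero I X i) => ((i : ℕ∞) : WithBot ℕ∞)) i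
    (localCohomologyNonzero_iff.2 h) le_rfl

lemma cohomDim_le {c : WithBot ℕ∞}
    (h : ∀ i, ¬ LocalCohomologyVanishes I i X → ((i : ℕ∞) : WithBot ℕ∞) ≤ c) : cohomDim I X ≤ c :=
  iSup₂_le fun i hi => h i (localCohomologyNonzero_iff.1 hi)

lemma cohomDim_eq {d : ℕ} (h : ¬ LocalCohomologyVanishes I d X)
    (h' : ∀ j, d < j → LocalCohomologyVanishes I j X) :
    cohomDim I X = ((d : ℕ∞) : WithBot ℕ∞) := by
  refine le_antisymm (cohomDim_le fun i hi => ?_) (le_cohomDim h)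
  have : i ≤ d := not_lt.1 fun hlt => hi (h' i hlt)
  exact_mod_cast this

lemma cohomDim_lt_natCast_iff {c : ℕ} : cohomDim I X < ((c : ℕ∞) : WithBot ℕ∞) ↔
    ∀ j, c ≤ j → LocalCohomologyVanishes I j X := by
  constructor
  · intro h j hj
    by_contra hv
    have h1 := (le_cohomDim hv).trans_lt h
    have h2 : j < c := by exact_mod_cast h1
    omega
  · intro h
    rcases c with _ | c
    · refine lt_of_le_of_lt (cohomDim_le (c := ⊥) fun i hi => (hi (h i (Nat.zero_le i))).elim) ?_
      exact WithBot.bot_lt_coe _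
    · refine lt_of_le_of_lt (cohomDim_le (c := ((c : ℕ∞) : WithBot ℕ∞)) fun i hi => ?_) ?_
      · have : i ≤ c := by
          by_contra hlt
          exact hi (h i (by omega))
        exact_mod_cast this
      · exact_mod_cast Nat.lt_succ_self c

lemma cohomDim_nonneg_iff : 0 ≤ cohomDim I X ↔ ∃ i, ¬ LocalCohomologyVanishes I i X := by
  have h := (cohomDim_lt_natCast_iff (I := I) (X := X) (c := 0)).not
  simp only [Nat.cast_zero, WithBot.coe_zero, not_lt, zero_le, true_implies, not_forall] at h
  exact h

lemma LocalCohomologyVanishes.of_subQuotient {N' N : Submodule R M} (h : N' ≤ N) {i : ℕ}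
    (h1 : LocalCohomologyVanishes I i N') (h2 : LocalCohomologyVanishes I i (SubQuotient N' N)) :
    LocalCohomologyVanishes I i N :=
  .of_exact_middle (f := Submodule.inclusion h) (g := (N'.submoduleOf N).mkQ)
    (Submodule.inclusion_injective h)
    (by
      rw [LinearMap.exact_iff, Submodule.ker_mkQ, Submodule.range_inclusion]
      rfl)
    (Submodule.mkQ_surjective _) h1 h2

lemma LocalCohomologyVanishes.subQuotient {N' N : Submodule R M} (h : N' ≤ N) {i : ℕ}
    (h1 : LocalCohomologyVanishes I i N) (h2 : LocalCohomologyVanishes I (i + 1) N') :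
    LocalCohomologyVanishes I i (SubQuotient N' N) :=
  .of_exact_right (f := Submodule.inclusion h) (g := (N'.submoduleOf N).mkQ)
    (Submodule.inclusion_injective h)
    (by
      rw [LinearMap.exact_iff, Submodule.ker_mkQ, Submodule.range_inclusion]
      rfl)
    (Submodule.mkQ_surjective _) h1 h2

/-- `M / N`, as a subquotient of `M`. -/
noncomputable def subQuotientTopEquiv (N : Submodule R M) : SubQuotient N ⊤ ≃ₗ[R] M ⧸ N :=
  Submodule.Quotient.equiv _ _ Submodule.topEquiv (by
    ext x
    simp [Submodule.submoduleOf])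

/-- `N / 0`, as a subquotient of `M`. -/
noncomputable def subQuotientBotEquiv (N : Submodule R M) : SubQuotient ⊥ N ≃ₗ[R] N :=
  Submodule.quotEquivOfEqBot _ (by simp [Submodule.submoduleOf])

lemma LocalCohomologyVanishes.iff_of_equiv {A B : Type u} [AddCommGroup A] [Module R A]
    [AddCommGroup B] [Module R B] (e : A ≃ₗ[R] B) {i : ℕ} :
    LocalCohomologyVanishes I i A ↔ LocalCohomologyVanishes I i B :=
  ⟨fun h => h.of_equiv e, fun h => h.of_equiv e.symm⟩

end Relative

/-! ### The unmixed component and the two implications -/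

section Graded

variable {K : Type u} [Field K] {m n : ℕ} {M : Type u} [AddCommGroup M]
  [Module (BiPoly K m n) M] {𝓜 : ℤ × ℤ → AddSubgroup M} [DirectSum.Decomposition 𝓜]

lemma IsHomogeneous.top : (⊤ : Submodule (BiPoly K m n) M).IsHomogeneous 𝓜 :=
  isHomogeneous_iff.2 fun _ _ _ => trivial

lemma IsHomogeneous.sup {N N' : Submodule (BiPoly K m n) M} (hN : N.IsHomogeneous 𝓜)
    (hN' : N'.IsHomogeneous 𝓜) : (N ⊔ N').IsHomogeneous 𝓜 :=
  isHomogeneous_iff.2 fun e x hx => by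
    obtain ⟨a, ha, b, hb, rfl⟩ := Submodule.mem_sup.1 hx
    rw [map_add]
    exact Submodule.add_mem_sup (isHomogeneous_iff.1 hN e a ha) (isHomogeneous_iff.1 hN' e b hb)

variable [SetLike.GradedSMul (bigrading K m n) 𝓜] [Module.Finite (BiPoly K m n) M]

/-- The cohomological dimension `d` of a nonzero graded submodule: it bounds that of every module
with a larger annihilator, and it is attained on every graded quotient of `M` in which the image
of the submodule is nonzero. -/
lemma exists_top_cohomology [Infinite K] {N : Submodule (BiPoly K m n) M}
    (hN : N.IsHomogeneous 𝓜) (hN0 : N ≠ ⊥) :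
    ∃ d, ¬ LocalCohomologyVanishes (idealQ K m n) d N ∧
      (∀ (X : Type u) [AddCommGroup X] [Module (BiPoly K m n) X],
        Module.annihilator (BiPoly K m n) N ≤ Module.annihilator (BiPoly K m n) X →
        ∀ j, d < j → LocalCohomologyVanishes (idealQ K m n) j X) ∧
      ∀ F : Submodule (BiPoly K m n) M, F.IsHomogeneous 𝓜 →
        (∀ i ≤ d, LocalCohomologyVanishes (idealQ K m n) i (M ⧸ F)) → N ≤ F := by
  obtain ⟨zs, hzs, hrad, hv⟩ := exists_parameters_not_vanishes hN hN0
  refine ⟨zs.length, hv, fun X _ _ hX j hj => ?_, fun F hF hvF => ?_⟩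
  · have htors : IsPowerTorsion (Module.annihilator (BiPoly K m n) N) X := fun x =>
      ⟨1, fun r hr => Module.mem_annihilator.1 (hX (by rwa [pow_one] at hr)) x⟩
    exact htors.vanishes_of_length_lt hzs hrad hj
  -- The image of `N` in `M/F` is killed by `ann N`, hence by some `s ∈ 1 + Q`; graded Nakayama then
  -- gives `N ≤ F`.
  · obtain ⟨s, hs, hsm⟩ := exists_sub_one_mem_smul_eq_zero hzs hrad hvF
    refine mem_of_smul_mem_of_sub_one_mem hF hN hs fun x hx => ?_
    rw [← Submodule.Quotient.mk_eq_zero, Submodule.Quotient.mk_smul]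
    refine hsm _ fun r hr => ?_
    rw [← Submodule.Quotient.mk_smul]
    have : r • x = 0 := congrArg Subtype.val (Module.mem_annihilator.1 hr ⟨x, hx⟩)
    rw [this, Submodule.Quotient.mk_zero]

lemma exists_cohomDim_eq [Infinite K] [Nontrivial M] (𝓜 : ℤ × ℤ → AddSubgroup M)
    [DirectSum.Decomposition 𝓜] [SetLike.GradedSMul (bigrading K m n) 𝓜] :
    ∃ c : ℕ, ¬ LocalCohomologyVanishes (idealQ K m n) c M ∧
      ∀ j, c < j → LocalCohomologyVanishes (idealQ K m n) j M := by
  obtain ⟨c, hc, hc', -⟩ := exists_top_cohomology (𝓜 := 𝓜)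
    (IsHomogeneous.top : (⊤ : Submodule (BiPoly K m n) M).IsHomogeneous 𝓜) top_ne_bot
  have e : (⊤ : Submodule (BiPoly K m n) M) ≃ₗ[BiPoly K m n] M := Submodule.topEquiv
  refine ⟨c, (LocalCohomologyVanishes.iff_of_equiv e).not.1 hc, hc' M ?_⟩
  rw [e.annihilator_eq]

lemma vanishes_of_le_grade [Nontrivial M] (𝓜 : ℤ × ℤ → AddSubgroup M)
    [DirectSum.Decomposition 𝓜] [SetLike.GradedSMul (bigrading K m n) 𝓜] {c : ℕ}
    (h : ((c : ℕ∞) : WithBot ℕ∞) ≤ (grade (idealQ K m n) M : WithBot ℕ∞) + 1) {i : ℕ}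
    (hi : i + 1 < c) : LocalCohomologyVanishes (idealQ K m n) i M := by
  -- Graded Nakayama excludes `QM = M`, so the default value `⊤` of the grade does not occur and
  -- long regular sequences really exist.
  have hQ : idealQ K m n • (⊤ : Submodule (BiPoly K m n) M) ≠ ⊤ := by
    intro htop
    obtain ⟨s, hs, hsm⟩ := Submodule.exists_sub_one_mem_and_smul_eq_zero_of_fg_of_le_smul
      (idealQ K m n) (⊤ : Submodule (BiPoly K m n) M) Module.Finite.fg_top htop.ge
    refine top_ne_bot (eq_bot_iff.2 (mem_of_smul_mem_of_sub_one_mem (𝓜 := 𝓜) IsHomogeneous.bot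
      (IsHomogeneous.top (K := K) (m := m) (n := n)) hs fun x hx => ?_))
    rw [hsm x hx]
    exact zero_mem _
  have h1 : (c : ℕ∞) ≤ grade (idealQ K m n) M + 1 := by exact_mod_cast h
  have h2 : ((i : ℕ) : ℕ∞) < grade (idealQ K m n) M := by
    have h3 : ((i + 1 : ℕ) : ℕ∞) < grade (idealQ K m n) M + 1 :=
      lt_of_lt_of_le (by exact_mod_cast hi) h1
    push_cast at h3
    exact (ENat.add_lt_add_iff_right ENat.one_ne_top).1 h3
  rw [grade, if_neg hQ] at h2
  obtain ⟨rs, hrs⟩ := lt_iSup_iff.1 h2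
  obtain ⟨⟨hrsQ, hreg⟩, hlt⟩ := lt_iSup_iff.1 hrs
  exact .of_isWeaklyRegular hrsQ hreg.toIsWeaklyRegular (by exact_mod_cast hlt)

/-- The sum of two graded submodules with local cohomology vanishing from degree `c` on has the
same property. -/
lemma vanishes_sup [Infinite K] {N N' : Submodule (BiPoly K m n) M}
    (hN' : N'.IsHomogeneous 𝓜) {c : ℕ}
    (hv : ∀ j, c ≤ j → LocalCohomologyVanishes (idealQ K m n) j N)
    (hv' : ∀ j, c ≤ j → LocalCohomologyVanishes (idealQ K m n) j N') :
    ∀ j, c ≤ j → LocalCohomologyVanishes (idealQ K m n) j (N ⊔ N' : Submodule _ M) := by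
  intro j hj
  rcases eq_or_ne N' ⊥ with rfl | hN0
  · rw [sup_bot_eq]
    exact hv j hj
  obtain ⟨d, hd, hd', -⟩ := exists_top_cohomology hN' hN0
  have hdc : d < c := not_le.1 fun hcd => hd (hv' d hcd)
  -- `(N + N')/N` is a quotient of `N'`, hence killed by `ann N'`, and so has no cohomology above
  -- `d`.
  refine (hv j hj).of_subQuotient le_sup_left (hd' _ (fun r hr => ?_) j (hdc.trans_le hj))
  rw [Module.mem_annihilator] at hr ⊢
  intro x
  obtain ⟨⟨x, hx⟩, rfl⟩ := Submodule.Quotient.mk_surjective _ x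
  obtain ⟨a, ha, b, hb, rfl⟩ := Submodule.mem_sup.1 hx
  rw [← Submodule.Quotient.mk_smul, Submodule.Quotient.mk_eq_zero]
  change r • (a + b) ∈ N
  have hb0 : r • b = 0 := congrArg Subtype.val (hr ⟨b, hb⟩)
  rw [smul_add, hb0, add_zero]
  exact N.smul_mem r ha

/-- The unmixed component is the largest graded submodule with local cohomology vanishing from
degree `cd(Q, M)` on. -/
lemma isGreatest_unmixedComponent [Infinite K] {c : ℕ}
    (hc : ¬ LocalCohomologyVanishes (idealQ K m n) c M)
    (hc' : ∀ j, c < j → LocalCohomologyVanishes (idealQ K m n) j M) :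
    IsGreatest {N : Submodule (BiPoly K m n) M | N.IsHomogeneous 𝓜 ∧
      ∀ j, c ≤ j → LocalCohomologyVanishes (idealQ K m n) j N}
      (unmixedComponent (idealQ K m n) 𝓜) := by
  have hset : {N : Submodule (BiPoly K m n) M | N.IsHomogeneous 𝓜 ∧
      cohomDim (idealQ K m n) N < cohomDim (idealQ K m n) M} =
      {N : Submodule (BiPoly K m n) M | N.IsHomogeneous 𝓜 ∧
        ∀ j, c ≤ j → LocalCohomologyVanishes (idealQ K m n) j N} := by
    ext N
    simp only [Set.mem_ofPred_eq, cohomDim_eq hc hc', cohomDim_lt_natCast_iff]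
  rw [unmixedComponent, hset]
  -- By noetherianity a maximal member exists; closure under sums makes it the greatest.
  obtain ⟨U, hU, hmax⟩ := WellFounded.has_min
    (wellFounded_gt : WellFounded ((· > ·) : Submodule (BiPoly K m n) M → _ → Prop))
    {N : Submodule (BiPoly K m n) M | N.IsHomogeneous 𝓜 ∧
        ∀ j, c ≤ j → LocalCohomologyVanishes (idealQ K m n) j N}
    ⟨⊥, IsHomogeneous.bot, fun j _ => .of_subsingleton j⟩
  have hg : IsGreatest {N : Submodule (BiPoly K m n) M | N.IsHomogeneous 𝓜 ∧
        ∀ j, c ≤ j → LocalCohomologyVanishes (idealQ K m n) j N} U := by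
    refine ⟨hU, fun N hN => ?_⟩
    have h1 := hmax (U ⊔ N) ⟨IsHomogeneous.sup hU.1 hN.1, vanishes_sup hN.1 hU.2 hN.2⟩
    rw [left_lt_sup, not_not] at h1
    exact h1
  rw [hg.isLUB.sSup_eq]
  exact hg

/-- The last proper term of the filtration turns out to be the unmixed component, so the last factor
is the required quotient. No grade bound enters this direction. -/
lemma IsCohenMacaulayFiltration.isCohenMacaulay_quotient [Infinite K] {c : ℕ}
    (hc : ¬ LocalCohomologyVanishes (idealQ K m n) c M)
    (hc' : ∀ j, c < j → LocalCohomologyVanishes (idealQ K m n) j M) {r : ℕ}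
    {F : Fin (r + 1) → Submodule (BiPoly K m n) M}
    (hF : IsCohenMacaulayFiltration (idealQ K m n) 𝓜 F) :
    IsCohenMacaulay (idealQ K m n) (M ⧸ unmixedComponent (idealQ K m n) 𝓜) := by
  have htopM : ∀ j, LocalCohomologyVanishes (idealQ K m n) j
      (⊤ : Submodule (BiPoly K m n) M) ↔ LocalCohomologyVanishes (idealQ K m n) j M := fun j =>
    LocalCohomologyVanishes.iff_of_equiv Submodule.topEquiv
  have hle : ∀ i : Fin r, F i.castSucc ≤ F i.succ := fun i =>
    hF.strictMono.monotone i.castSucc_lt_succ.le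
  have hq : ∀ i : Fin r, ∃ q : ℕ,
      ¬ LocalCohomologyVanishes (idealQ K m n) q (SubQuotient (F i.castSucc) (F i.succ)) ∧
      ∀ j, j ≠ q →
        LocalCohomologyVanishes (idealQ K m n) j (SubQuotient (F i.castSucc) (F i.succ)) := by
    intro i
    obtain ⟨q, hq⟩ := isCohenMacaulay_iff.1 (hF.isCohenMacaulay i)
    obtain ⟨j, hj⟩ := cohomDim_nonneg_iff.1 (hF.cohomDim_nonneg i)
    obtain rfl : j = q := by
      by_contra hne
      exact hj (hq j hne)
    exact ⟨j, hj, hq⟩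
  choose q hq hq' using hq
  have hmono : StrictMono q := by
    intro i j hij
    have h1 := hF.cohomDim_strictMono hij
    simp only [cohomDim_eq (hq i) fun k hk => hq' i k hk.ne',
      cohomDim_eq (hq j) fun k hk => hq' j k hk.ne'] at h1
    exact_mod_cast h1
  -- Cohomology of `F k` occurs only in the degrees `q i` of the factors below it.
  have hvan : ∀ (k : Fin (r + 1)) (j : ℕ), (∀ i : Fin r, i.castSucc < k → q i ≠ j) →
      LocalCohomologyVanishes (idealQ K m n) j (F k) := by
    intro k
    induction k using Fin.induction with
    | zero =>
      intro j _
      rw [hF.bot]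
      exact .of_subsingleton j
    | succ k ih =>
      intro j hj
      exact (ih j fun i hi => hj i (hi.trans k.castSucc_lt_succ)).of_subQuotient (hle k)
        (hq' k j (hj k k.castSucc_lt_succ).symm)
  rcases r with _ | r
  · refine (hc ((htopM c).1 ?_)).elim
    rw [← hF.top]
    exact hvan _ c fun i => i.elim0
  set l : Fin (r + 1) := Fin.last r with hl
  have htop : F l.succ = ⊤ := hF.top
  have hlt : ∀ i : Fin (r + 1), i.castSucc < l.castSucc → q i < q l := fun i hi =>
    hmono (by simpa using hi)
  have hql : ¬ LocalCohomologyVanishes (idealQ K m n) (q l) M := by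
    intro hv
    refine hq l (LocalCohomologyVanishes.subQuotient (hle l) ?_ ?_)
    · rw [htop]
      exact (htopM _).2 hv
    · exact hvan _ _ fun i hi => by
        have := hlt i hi
        omega
  have hqc : q l = c := by
    refine le_antisymm (not_lt.1 fun h => hql (hc' _ h)) (not_lt.1 fun h => hc ((htopM c).1 ?_))
    rw [← htop]
    refine hvan _ _ fun i _ => ?_
    have : q i ≤ q l := hmono.monotone (Fin.le_last i)
    omega
  have hequiv : ∀ j, LocalCohomologyVanishes (idealQ K m n) j
      (SubQuotient (F l.castSucc) (F l.succ)) ↔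
      LocalCohomologyVanishes (idealQ K m n) j (M ⧸ F l.castSucc) := by
    intro j
    rw [htop]
    exact LocalCohomologyVanishes.iff_of_equiv (subQuotientTopEquiv _)
  have hquot : ∀ j, j ≠ c → LocalCohomologyVanishes (idealQ K m n) j (M ⧸ F l.castSucc) :=
    fun j hj => (hequiv j).1 (hq' l j (hqc ▸ hj))
  have hU := isGreatest_unmixedComponent (𝓜 := 𝓜) hc hc'
  have hUF : unmixedComponent (idealQ K m n) 𝓜 = F l.castSucc := by
    refine le_antisymm ?_ (hU.2 ⟨hF.homogeneous _, fun j hj => hvan _ _ fun i hi => ?_⟩)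
    · rcases eq_or_ne (unmixedComponent (idealQ K m n) 𝓜) ⊥ with h0 | h0
      · rw [h0]
        exact bot_le
      -- The unmixed component has top degree `d < c`, while `M/F` has no cohomology below `c`, so
      -- the component maps to zero in `M/F`.
      · obtain ⟨d, hd, -, hd'⟩ := exists_top_cohomology hU.1.1 h0
        refine hd' _ (hF.homogeneous _) fun i hi => hquot i ?_
        have : d < c := not_le.1 fun hcd => hd (hU.1.2 d hcd)
        omega
    · have := hlt i hi
      omega
  rw [hUF]
  exact isCohenMacaulay_iff.2 ⟨c, hquot⟩

/-- `U` is squeezed into degree `c - 1`: from above by its definition, from below by the vanishing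
for `M` and for `M/U` one degree lower. The filtration has one step if `U = 0` and two otherwise. -/
lemma isSequentiallyCohenMacaulay_of_quotient [Infinite K] [Nontrivial M] {c : ℕ}
    (hc : ¬ LocalCohomologyVanishes (idealQ K m n) c M)
    (hc' : ∀ j, c < j → LocalCohomologyVanishes (idealQ K m n) j M)
    (hlow : ∀ i, i + 1 < c → LocalCohomologyVanishes (idealQ K m n) i M)
    (h : IsCohenMacaulay (idealQ K m n) (M ⧸ unmixedComponent (idealQ K m n) 𝓜)) :
    IsSequentiallyCohenMacaulay (idealQ K m n) 𝓜 := by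
  have hU := isGreatest_unmixedComponent (𝓜 := 𝓜) hc hc'
  set U := unmixedComponent (idealQ K m n) 𝓜 with hUdef
  have hex : Function.Exact U.subtype U.mkQ := by
    rw [LinearMap.exact_iff, Submodule.ker_mkQ, Submodule.range_subtype]
  have hcU : ¬ LocalCohomologyVanishes (idealQ K m n) c (M ⧸ U) := fun hv =>
    hc (.of_exact_middle (f := U.subtype) (g := U.mkQ) U.injective_subtype hex
      (Submodule.mkQ_surjective _) (hU.1.2 c le_rfl) hv)
  have hqU : ∀ j, j ≠ c → LocalCohomologyVanishes (idealQ K m n) j (M ⧸ U) := by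
    obtain ⟨q, hq⟩ := isCohenMacaulay_iff.1 h
    obtain rfl : c = q := by
      by_contra hne
      exact hcU (hq c hne)
    exact hq
  have hUtop : ∀ j, LocalCohomologyVanishes (idealQ K m n) j (SubQuotient U ⊤) ↔
      LocalCohomologyVanishes (idealQ K m n) j (M ⧸ U) := fun j =>
    LocalCohomologyVanishes.iff_of_equiv (subQuotientTopEquiv U)
  have hCMtop : IsCohenMacaulay (idealQ K m n) (SubQuotient U ⊤) :=
    isCohenMacaulay_iff.2 ⟨c, fun j hj => (hUtop j).2 (hqU j hj)⟩
  have htop0 : 0 ≤ cohomDim (idealQ K m n) (SubQuotient U ⊤) :=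
    cohomDim_nonneg_iff.2 ⟨c, (hUtop c).not.2 hcU⟩
  rcases eq_or_ne U ⊥ with h0 | h0
  · rw [h0] at hCMtop htop0
    refine ⟨1, ![⊥, ⊤], ?_, rfl, rfl, ?_, ?_, ?_, ?_⟩
    · intro i
      fin_cases i
      · exact IsHomogeneous.bot
      · exact IsHomogeneous.top
    · rw [Fin.strictMono_iff_lt_succ]
      intro i
      fin_cases i
      exact bot_lt_top
    · intro i
      fin_cases i
      exact hCMtop
    · intro i
      fin_cases i
      exact htop0
    · exact Subsingleton.strictMono _
  · have hbot : ∀ j, LocalCohomologyVanishes (idealQ K m n) j (SubQuotient ⊥ U) ↔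
        LocalCohomologyVanishes (idealQ K m n) j U := fun j =>
      LocalCohomologyVanishes.iff_of_equiv (subQuotientBotEquiv U)
    have hCMU : IsCohenMacaulay (idealQ K m n) (SubQuotient ⊥ U) := by
      refine isCohenMacaulay_iff.2 ⟨c - 1, fun j hj => (hbot j).2 ?_⟩
      rcases le_or_gt c j with hcj | hcj
      · exact hU.1.2 j hcj
      · exact .of_exact_left (f := U.subtype) (g := U.mkQ) U.injective_subtype hex
          (Submodule.mkQ_surjective _) (hlow j (by omega)) fun i hi => hqU i (by omega)
    have hU0 : 0 ≤ cohomDim (idealQ K m n) (SubQuotient ⊥ U) := by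
      obtain ⟨d, hd, -⟩ := exists_top_cohomology hU.1.1 h0
      exact cohomDim_nonneg_iff.2 ⟨d, (hbot d).not.2 hd⟩
    have hUlt : U < ⊤ := by
      refine lt_top_iff_ne_top.2 fun hUt => hcU ?_
      rw [hUt]
      exact .of_subsingleton c
    have hcd : cohomDim (idealQ K m n) (SubQuotient ⊥ U) <
        cohomDim (idealQ K m n) (SubQuotient U ⊤) :=
      (cohomDim_lt_natCast_iff.2 fun j hj => (hbot j).2 (hU.1.2 j hj)).trans_le
        (le_cohomDim ((hUtop c).not.2 hcU))
    refine ⟨2, ![⊥, U, ⊤], ?_, rfl, rfl, ?_, ?_, ?_, ?_⟩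
    · intro i
      fin_cases i
      · exact IsHomogeneous.bot
      · exact hU.1.1
      · exact IsHomogeneous.top
    · rw [Fin.strictMono_iff_lt_succ]
      intro i
      fin_cases i
      · exact bot_lt_iff_ne_bot.2 h0
      · exact hUlt
    · intro i
      fin_cases i
      · exact hCMU
      · exact hCMtop
    · intro i
      fin_cases i
      · exact hU0
      · exact htop0
    · rw [Fin.strictMono_iff_lt_succ]
      intro i
      fin_cases i
      exact hcd

end Graded

end BigradedCM

theorem proposition4p2 {K : Type u} [Field K] [Infinite K] (m n : ℕ)
    {M : Type u} [AddCommGroup M] [Module (BigradedCM.BiPoly K m n) M]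
    [Module.Finite (BigradedCM.BiPoly K m n) M]
    (𝓜 : ℤ × ℤ → AddSubgroup M) [DirectSum.Decomposition 𝓜]
    [SetLike.GradedSMul (BigradedCM.bigrading K m n) 𝓜] :
    BigradedCM.IsApproximatelyCohenMacaulay (BigradedCM.idealQ K m n) 𝓜 ↔
      (BigradedCM.IsSequentiallyCohenMacaulay (BigradedCM.idealQ K m n) 𝓜 ∧
        BigradedCM.cohomDim (BigradedCM.idealQ K m n) M ≤
          (BigradedCM.grade (BigradedCM.idealQ K m n) M : WithBot ℕ∞) + 1) := by
  rw [BigradedCM.IsApproximatelyCohenMacaulay, and_congr_left_iff]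
  intro hgrade
  rcases subsingleton_or_nontrivial M with hM | hM
  -- For `M = 0` the filtration of length `0` serves, and `M/U` is zero.
  · refine iff_of_true (BigradedCM.isCohenMacaulay_iff.2 ⟨0, fun i _ => .of_subsingleton i⟩)
      ⟨0, fun _ => ⊥, fun _ => BigradedCM.IsHomogeneous.bot, rfl, Subsingleton.elim _ _,
        Fin.strictMono_iff_lt_succ.2 fun i => i.elim0, fun i => i.elim0, fun i => i.elim0,
        fun i => i.elim0⟩
  · obtain ⟨c, hc, hc'⟩ := BigradedCM.exists_cohomDim_eq (K := K) (m := m) (n := n) 𝓜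
    rw [BigradedCM.cohomDim_eq hc hc'] at hgrade
    exact ⟨BigradedCM.isSequentiallyCohenMacaulay_of_quotient hc hc' fun i hi =>
      BigradedCM.vanishes_of_le_grade 𝓜 hgrade hi,
      fun ⟨_, _, hF⟩ => hF.isCohenMacaulay_quotient hc hc'⟩
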